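/- All codes are qubit CSS codes. A code with $X$- and $Z$-parity-check matrices $P_X,P_Z$ over $\mathbb F_2$ ($P_XP_Z^{\mathsf T}=0$) is identified with the complex of based spaces $C_\bullet=(C_1\xrightarrow{P_Z^{\mathsf T}}C_0\xrightarrow{P_X}C_{-1})$ and its dual. $H_0(C_\bullet)$ is the space of logical $\overline Z$ operators, $d^Z_C$ the least weight of a vector in $\ker P_X\setminus\operatorname{im}P_Z^{\mathsf T}$, $d^X_C$ the same for the dual, $d_C=\min(d^Z_C,d^X_C)$. A basis of $H_0(C_\bullet)$ fixes a decomposition into logical qubits. Let $C,D$ be CSS codes with bases $\{[u]_i\}_{i\in I}$, $\{[v]_j\}_{j\in J}$ of $H_0(C_\bullet)$, $H_0(D_\bullet)$. Let $V_\bullet=(V_0\xrightarrow{\partial}V_{-1})$ with $V_{-1}=\operatorname{im}\partial$ be simultaneously a logical operator subcomplex of $C_\bullet$ and $D_\bullet$. That is, there are chain maps $f\colon V_\bullet\to C_\bullet$ and $g\colon V_\bullet\to D_\bullet$, injective in each degree, where $f_0$ and $g_0$ map the basis of $V_0$ bijectively onto the supports of $u\in C_0$ and $v\in D_0$, which are cycles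 and not boundaries. Let $V_\bullet$ be separated, that is: - $[u]=[u]_{i_0}$ and $[v]=[v]_{j_0}$ for some $i_0\in I$, $j_0\in J$; - every nontrivial logical $\overline Z$ operator of $C$ (resp. $D$) supported in $\operatorname{supp}u$ (resp. $\operatorname{supp}v$) is in the class $[u]$ (resp. $[v]$); - for $s\in V_0$, $f_0(s)$ is a nontrivial logical operator if and only if $g_0(s)$ is. Let $P_\bullet=(\mathbb F_2\xrightarrow{(1,1)^{\mathsf T}}\mathbb F_2^2)$, and let $T$ be the sandwiched code: $T_\bullet$ is obtained from $C_\bullet$, $(P\otimes V)_\bullet$, $D_\bullet$ by gluing (pushout) the two ends of $P\otimes V$ to $C$ and to $D$ along $V$. Thus $T_1=C_1\oplus D_1\oplus V_0$, $T_0=C_0\oplus D_0\oplus V_{-1}$, $T_{-1}=C_{-1}\oplus D_{-1}$. Call the $\dim V_{-1}$ qubits of $T$ that lie in neither $C$ nor $D$ the intermediate qubits. Let $\iota\colon (C\oplus D)_\bullet\to T_\bullet$ be the inclusion. **Claim.** 1. $H_0(T_\bullet)$ has a basis $\{[w]_k\}$ indexed by $(I\sqcup J)\setminus\{j_0\}$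 such that $H_0(\iota)$ sends $[u]_i\mapsto[w]_i$, sends $[v]_j\mapsto[w]_j$ for $j\ne j_0$, and sends $[v]_{j_0}\mapsto[w]_{i_0}$. Hence the $\overline X$-preserving code map $(\iota,\iota^*)$ from $T$ to $C\oplus D$ acts on logical qubits, as the linear map $|b\rangle\mapsto|H_0(\iota)^{\mathsf T}b\rangle$, by the $\overline X$-split $\mathcal E_{\overline X}$. This is $|0\rangle\mapsto|00\rangle$, $|1\rangle\mapsto|11\rangle$ from logical qubit $i_0$ of $T$ to the pair $i_0,j_0$ of $C\oplus D$, and the identity on all other logical qubits. 2. Let $d=\min(d_{C\oplus D},\,d^Z_T)$. (So $d=d_{C\oplus D}$ whenever $T$ has distance bounded below, i.e. has no nontrivial logical $\overline Z$ operator of weight less than $d_{C\oplus D}$.) For every $R\ge d$ consider the procedure: measure out the intermediate qubits in the $X$-basis; measure all stabiliser generators of $C\oplus D$ for $R$ rounds; apply a Pauli correction computed from the measurement record. The correction rule can be chosen such that: - without faults, in every measurement branch, the procedure maps each encoded state of $T$ with logical state $\varphi$ to the encoded state of $C\oplus D$ with logical state $\mathcal E_{\overline X}\varphi$, with an amplitude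 independent of $\varphi$; - the procedure is fault-tolerant with distance $d$ in the following sense. Suppose that the incoming encoded state has a Pauli error of weight $r$, and that $s$ faults occur during the procedure (single-qubit Pauli errors on the data qubits before each round and after the last one, and flips of reported measurement outcomes, including those of the intermediate qubits). If $2(r+s)<d$, or if $r+s<d$ and the faults are undetected (the reported record is one that can occur for some encoded input without faults), then in every branch the output is the encoded state of $\mathcal E_{\overline X}\varphi$ up to a Pauli error of weight at most $s$, with the error and amplitude independent of $\varphi$. -/

import Mathlib

set_option linter.unusedSectionVars false

open Matrix

/-- A CSS code with `Z`-type generators `Z`, physical qubits `Q` and `X`-type generators `X`.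
It is the length-2 complex `C₁ --HZᵀ--> C₀ --HX--> C₋₁` of based `𝔽₂`-vector spaces with
`C₁ = 𝔽₂^Z`, `C₀ = 𝔽₂^Q`, `C₋₁ = 𝔽₂^X`, together with its dual (the transposed complex).
Vectors in `C₀` are `Z`-operators; vectors in the dual of `C₀` are `X`-operators. -/
structure CSSCode (Z Q X : Type*) [Fintype Q] where
  HZ : Matrix Z Q (ZMod 2)
  HX : Matrix X Q (ZMod 2)
  comm : HX * HZᵀ = 0

/-- A chain map between the `Z`-type complexes of two CSS codes. Its transpose is a chain map
between the dual complexes in the opposite direction; the pair is a code map. -/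
@[ext]
structure CodeMap {Z Q X Z' Q' X' : Type*} [Fintype Z] [Fintype Q] [Fintype X]
    [Fintype Z'] [Fintype Q'] [Fintype X'] (C : CSSCode Z Q X) (D : CSSCode Z' Q' X') where
  f₁ : Matrix Z' Z (ZMod 2)
  f₀ : Matrix Q' Q (ZMod 2)
  fm : Matrix X' X (ZMod 2)
  comm₁ : f₀ * C.HZᵀ = D.HZᵀ * f₁
  comm₀ : fm * C.HX = D.HX * f₀

namespace CSSCode

section Homology

variable {Z Q X : Type*} [Fintype Z] [Fintype Q] [Fintype X]

/-- The dual complex: the same code with the roles of `Z` and `X` exchanged. -/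
def dual (C : CSSCode Z Q X) : CSSCode X Q Z where
  HZ := C.HX
  HX := C.HZ
  comm := by
    have h := congrArg Matrix.transpose C.comm
    simpa [Matrix.transpose_mul] using h

/-- `Z₀`: the undetectable `Z`-operators. -/
def cycles (C : CSSCode Z Q X) : Submodule (ZMod 2) (Q → ZMod 2) :=
  LinearMap.ker C.HX.mulVecLin

/-- `B₀`: the products of `Z`-type generators. -/
def boundaries (C : CSSCode Z Q X) : Submodule (ZMod 2) (Q → ZMod 2) :=
  LinearMap.range C.HZᵀ.mulVecLin

/-- `H₀ = Z₀ / B₀`: the space of logical `Z`-operators. -/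
abbrev H0 (C : CSSCode Z Q X) : Type _ :=
  C.cycles ⧸ C.boundaries.comap C.cycles.subtype

/-- The homology class of a cycle. -/
def cls (C : CSSCode Z Q X) (z : Q → ZMod 2) (hz : z ∈ C.cycles) : C.H0 :=
  Submodule.Quotient.mk ⟨z, hz⟩

theorem cls_add (C : CSSCode Z Q X) (y z : Q → ZMod 2) (hy : y ∈ C.cycles) (hz : z ∈ C.cycles) :
    C.cls y hy + C.cls z hz = C.cls (y + z) (C.cycles.add_mem hy hz) := rfl

theorem cls_congr (C : CSSCode Z Q X) {y z : Q → ZMod 2} (h : y = z) (hy : y ∈ C.cycles)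
    (hz : z ∈ C.cycles) : C.cls y hy = C.cls z hz := by
  subst h; rfl

/-- The nontrivial logical `Z`-operators, `Z₀ \ B₀`. -/
def IsLogicalZ (C : CSSCode Z Q X) (z : Q → ZMod 2) : Prop :=
  z ∈ C.cycles ∧ z ∉ C.boundaries

/-- `d^Z`, the systolic distance. -/
noncomputable def distZ (C : CSSCode Z Q X) : ℕ :=
  sInf {n | ∃ z, C.IsLogicalZ z ∧ hammingNorm z = n}

/-- The code distance `d = min(d^Z, d^X)`. -/
noncomputable def dist (C : CSSCode Z Q X) : ℕ :=
  min C.distZ C.dual.distZ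

/-- The pairing of logical `Z`-operators with an undetectable `X`-operator `y`
(whether they anticommute), on homology classes. -/
def pairing (C : CSSCode Z Q X) (y : Q → ZMod 2) (hy : C.HZ *ᵥ y = 0) :
    C.H0 →ₗ[ZMod 2] ZMod 2 :=
  Submodule.liftQ _
    ({ toFun := fun z => (z : Q → ZMod 2) ⬝ᵥ y
       map_add' := fun a b => by simp
       map_smul' := fun a b => by simp } : C.cycles →ₗ[ZMod 2] ZMod 2)
    (by
      rintro ⟨z, hz⟩ hb
      obtain ⟨c, rfl⟩ := hb
      simp [← Matrix.dotProduct_mulVec, hy])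

end Homology

end CSSCode

namespace CodeMap

/-- Composition of chain maps. -/
def comp {Z Q X Z' Q' X' Z'' Q'' X'' : Type*} [Fintype Z] [Fintype Q] [Fintype X]
    [Fintype Z'] [Fintype Q'] [Fintype X'] [Fintype Z''] [Fintype Q''] [Fintype X'']
    {C : CSSCode Z Q X} {D : CSSCode Z' Q' X'} {E : CSSCode Z'' Q'' X''}
    (g : CodeMap D E) (f : CodeMap C D) : CodeMap C E where
  f₁ := g.f₁ * f.f₁
  f₀ := g.f₀ * f.f₀
  fm := g.fm * f.fm
  comm₁ := by rw [Matrix.mul_assoc, f.comm₁, ← Matrix.mul_assoc, g.comm₁, Matrix.mul_assoc]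
  comm₀ := by rw [Matrix.mul_assoc, f.comm₀, ← Matrix.mul_assoc, g.comm₀, Matrix.mul_assoc]

section Maps

variable {Z Q X Z' Q' X' : Type*} [Fintype Z] [Fintype Q] [Fintype X]
    [Fintype Z'] [Fintype Q'] [Fintype X'] {C : CSSCode Z Q X} {D : CSSCode Z' Q' X'}

theorem map_cycles (f : CodeMap C D) (z : Q → ZMod 2) (hz : z ∈ C.cycles) :
    f.f₀ *ᵥ z ∈ D.cycles := by
  have h : C.HX *ᵥ z = 0 := hz
  change D.HX *ᵥ (f.f₀ *ᵥ z) = 0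
  rw [Matrix.mulVec_mulVec, ← f.comm₀, ← Matrix.mulVec_mulVec, h, Matrix.mulVec_zero]

theorem map_boundaries (f : CodeMap C D) (z : Q → ZMod 2) (hz : z ∈ C.boundaries) :
    f.f₀ *ᵥ z ∈ D.boundaries := by
  obtain ⟨c, rfl⟩ := hz
  refine ⟨f.f₁ *ᵥ c, ?_⟩
  simp only [Matrix.mulVecLin_apply, Matrix.mulVec_mulVec, f.comm₁]

/-- The induced map `H₀(f)` on logical `Z`-operators. -/
def mapH0 (f : CodeMap C D) : C.H0 →ₗ[ZMod 2] D.H0 :=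
  Submodule.mapQ _ _
    (f.f₀.mulVecLin.restrict (p := C.cycles) (q := D.cycles) f.map_cycles)
    (fun z hz => f.map_boundaries z hz)

theorem mapH0_cls (f : CodeMap C D) (z : Q → ZMod 2) (hz : z ∈ C.cycles) :
    f.mapH0 (C.cls z hz) = D.cls (f.f₀ *ᵥ z) (f.map_cycles z hz) := rfl

end Maps

end CodeMap

section DirectSum

variable {Z₁ Q₁ X₁ Z₂ Q₂ X₂ : Type*} [Fintype Z₁] [Fintype Q₁] [Fintype X₁]
    [Fintype Z₂] [Fintype Q₂] [Fintype X₂]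

/-- The direct sum of two codes: both codes in parallel on disjoint sets of qubits. -/
def CSSCode.directSum (C : CSSCode Z₁ Q₁ X₁) (D : CSSCode Z₂ Q₂ X₂) :
    CSSCode (Z₁ ⊕ Z₂) (Q₁ ⊕ Q₂) (X₁ ⊕ X₂) where
  HZ := fromBlocks C.HZ 0 0 D.HZ
  HX := fromBlocks C.HX 0 0 D.HX
  comm := by
    simp [Matrix.fromBlocks_transpose, Matrix.fromBlocks_multiply, C.comm, D.comm]

variable (C : CSSCode Z₁ Q₁ X₁) (D : CSSCode Z₂ Q₂ X₂)

/-- The inclusion of the first summand. -/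
def CodeMap.inl [DecidableEq Z₁] [DecidableEq Q₁] [DecidableEq X₁] :
    CodeMap C (C.directSum D) where
  f₁ := fromRows 1 0
  f₀ := fromRows 1 0
  fm := fromRows 1 0
  comm₁ := by
    simp [CSSCode.directSum, Matrix.fromBlocks_transpose, Matrix.fromRows_mul,
      Matrix.fromBlocks_mul_fromRows]
  comm₀ := by
    simp [CSSCode.directSum, Matrix.fromRows_mul, Matrix.fromBlocks_mul_fromRows]

/-- The inclusion of the second summand. -/
def CodeMap.inr [DecidableEq Z₂] [DecidableEq Q₂] [DecidableEq X₂] :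
    CodeMap D (C.directSum D) where
  f₁ := fromRows 0 1
  f₀ := fromRows 0 1
  fm := fromRows 0 1
  comm₁ := by
    simp [CSSCode.directSum, Matrix.fromBlocks_transpose, Matrix.fromRows_mul,
      Matrix.fromBlocks_mul_fromRows]
  comm₀ := by
    simp [CSSCode.directSum, Matrix.fromRows_mul, Matrix.fromBlocks_mul_fromRows]

/-- The projection onto the first summand. -/
def CodeMap.fst [DecidableEq Z₁] [DecidableEq Q₁] [DecidableEq X₁] :
    CodeMap (C.directSum D) C where
  f₁ := fromCols 1 0
  f₀ := fromCols 1 0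
  fm := fromCols 1 0
  comm₁ := by
    simp [CSSCode.directSum, Matrix.fromBlocks_transpose, Matrix.mul_fromCols,
      Matrix.fromCols_mul_fromBlocks]
  comm₀ := by
    simp [CSSCode.directSum, Matrix.mul_fromCols, Matrix.fromCols_mul_fromBlocks]

/-- The projection onto the second summand. -/
def CodeMap.snd [DecidableEq Z₂] [DecidableEq Q₂] [DecidableEq X₂] :
    CodeMap (C.directSum D) D where
  f₁ := fromCols 0 1
  f₀ := fromCols 0 1
  fm := fromCols 0 1
  comm₁ := by
    simp [CSSCode.directSum, Matrix.fromBlocks_transpose, Matrix.mul_fromCols,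
      Matrix.fromCols_mul_fromBlocks]
  comm₀ := by
    simp [CSSCode.directSum, Matrix.mul_fromCols, Matrix.fromCols_mul_fromBlocks]

variable [DecidableEq Z₁] [DecidableEq Q₁] [DecidableEq X₁]
  [DecidableEq Z₂] [DecidableEq Q₂] [DecidableEq X₂]

/-- `H₀(C ⊕ D) = H₀(C) ⊕ H₀(D)`, through the inclusions of the summands. -/
def CSSCode.directSumH0 : (C.H0 × D.H0) ≃ₗ[ZMod 2] (C.directSum D).H0 :=
  LinearEquiv.ofLinearMap
    ((CodeMap.inl C D).mapH0.coprod (CodeMap.inr C D).mapH0)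
    ((CodeMap.fst C D).mapH0.prod (CodeMap.snd C D).mapH0)
    (by
      refine LinearMap.ext fun x => ?_
      obtain ⟨⟨z, hz⟩, rfl⟩ := Submodule.Quotient.mk_surjective _ x
      change (CodeMap.inl C D).mapH0 ((CodeMap.fst C D).mapH0 ((C.directSum D).cls z hz)) +
        (CodeMap.inr C D).mapH0 ((CodeMap.snd C D).mapH0 ((C.directSum D).cls z hz)) =
        (C.directSum D).cls z hz
      simp only [CodeMap.mapH0_cls, CSSCode.cls_add]
      refine CSSCode.cls_congr _ ?_ _ _
      ext (q | q) <;>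
        simp [CodeMap.inl, CodeMap.inr, CodeMap.fst, CodeMap.snd,
          Matrix.fromRows_mulVec, Matrix.fromCols_mulVec])
    (by
      refine LinearMap.ext fun x => ?_
      obtain ⟨x, y⟩ := x
      obtain ⟨⟨z, hz⟩, rfl⟩ := Submodule.Quotient.mk_surjective _ x
      obtain ⟨⟨t, ht⟩, rfl⟩ := Submodule.Quotient.mk_surjective _ y
      change ((CodeMap.fst C D).mapH0 ((CodeMap.inl C D).mapH0 (C.cls z hz) +
          (CodeMap.inr C D).mapH0 (D.cls t ht)),
        (CodeMap.snd C D).mapH0 ((CodeMap.inl C D).mapH0 (C.cls z hz) +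
          (CodeMap.inr C D).mapH0 (D.cls t ht))) = (C.cls z hz, D.cls t ht)
      simp only [CodeMap.mapH0_cls, CSSCode.cls_add]
      refine Prod.ext (CSSCode.cls_congr _ ?_ _ _) (CSSCode.cls_congr _ ?_ _ _) <;>
      · ext q
        simp [CodeMap.inl, CodeMap.inr, CodeMap.fst, CodeMap.snd,
          Matrix.fromRows_mulVec, Matrix.fromCols_mulVec])

/-- The basis of logical `Z`-operators of `C ⊕ D` obtained from bases for `C` and `D`:
the class `[u]_i` of the first summand has index `Sum.inl i`, and `[v]_j` of the second
has index `Sum.inr j`. -/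
noncomputable def CSSCode.sumBasis {I J : Type*} (bC : Module.Basis I (ZMod 2) C.H0)
    (bD : Module.Basis J (ZMod 2) D.H0) :
    Module.Basis (I ⊕ J) (ZMod 2) (C.directSum D).H0 :=
  (bC.prod bD).map (CSSCode.directSumH0 C D)

end DirectSum

section Sandwich

variable {Z₁ Q₁ X₁ Z₂ Q₂ X₂ V₀ Vm : Type*} [Fintype Z₁] [Fintype Q₁] [Fintype X₁]
    [Fintype Z₂] [Fintype Q₂] [Fintype X₂] [Fintype V₀] [Fintype Vm]

/-- `V`, embedded by `f`, is the logical operator subcomplex of `C` for the logical operator `u`: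
`u` is a cycle and not a boundary; `V₁ = 0`; the basis of `V₀` is mapped by `f₀` bijectively
onto the basis vectors in the support of `u`; and `V₋₁` is the image of the restriction of the
differential `HX` to the span of that support, that is, the differential of `V` is onto,
`f₋₁` is injective, and the two commute with the differentials (as `f` is a chain map). -/
structure IsLogicalOperatorSubcomplex (V : CSSCode Empty V₀ Vm) (C : CSSCode Z₁ Q₁ X₁)
    (f : CodeMap V C) (u : Q₁ → ZMod 2) : Prop where
  logical : C.IsLogicalZ u
  basis : ∃ e : V₀ ↪ Q₁, (∀ i, f.f₀ (e i) i = 1) ∧ (∀ q i, q ≠ e i → f.f₀ q i = 0) ∧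
    ∀ q, q ∈ Set.range e ↔ u q ≠ 0
  onto : Function.Surjective V.HX.mulVec
  inj : Function.Injective f.fm.mulVec

/-- `V` is a separated logical operator subcomplex of `C` and `D` (for the logical operators
`u` and `v`, and the bases `bC`, `bD` of logical `Z`-operators): `u` and `v` each represent one
basis element, every nontrivial logical operator supported in `supp u` (resp. `supp v`) is
in the class of `u` (resp. `v`), and a vector of `V₀` is a nontrivial logical operator in `C`
if and only if it is one in `D`. -/
structure IsSeparated {I J : Type*} (V : CSSCode Empty V₀ Vm) (C : CSSCode Z₁ Q₁ X₁)
    (D : CSSCode Z₂ Q₂ X₂) (f : CodeMap V C) (g : CodeMap V D)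
    (u : Q₁ → ZMod 2) (v : Q₂ → ZMod 2)
    (bC : Module.Basis I (ZMod 2) C.H0) (bD : Module.Basis J (ZMod 2) D.H0)
    (i₀ : I) (j₀ : J) : Prop where
  class_u : ∃ h : u ∈ C.cycles, C.cls u h = bC i₀
  class_v : ∃ h : v ∈ D.cycles, D.cls v h = bD j₀
  only_u : ∀ u' (h : u' ∈ C.cycles), u' ∉ C.boundaries →
    (∀ q, u' q ≠ 0 → u q ≠ 0) → C.cls u' h = bC i₀
  only_v : ∀ v' (h : v' ∈ D.cycles), v' ∉ D.boundaries →
    (∀ q, v' q ≠ 0 → v q ≠ 0) → D.cls v' h = bD j₀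
  iff_logical : ∀ s : V₀ → ZMod 2, C.IsLogicalZ (f.f₀ *ᵥ s) ↔ D.IsLogicalZ (g.f₀ *ᵥ s)

/-- The sandwiched code `T` of `C` and `D` along `V`, with
`T₁ = C₁ ⊕ D₁ ⊕ V₀`, `T₀ = C₀ ⊕ D₀ ⊕ V₋₁`, `T₋₁ = C₋₁ ⊕ D₋₁`.
It is the pushout of a pushout that glues the two ends of `P ⊗ V` to `C` and to `D`, see
`sandwich_isColimit`. The qubits indexed by `Vm` are the intermediate qubits, those of `P ⊗ V`
that belong neither to `C` nor to `D`. -/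
def sandwich (V : CSSCode Empty V₀ Vm) (C : CSSCode Z₁ Q₁ X₁) (D : CSSCode Z₂ Q₂ X₂)
    (f : CodeMap V C) (g : CodeMap V D) :
    CSSCode ((Z₁ ⊕ Z₂) ⊕ V₀) ((Q₁ ⊕ Q₂) ⊕ Vm) (X₁ ⊕ X₂) where
  HZ := fromBlocks (fromBlocks C.HZ 0 0 D.HZ) 0 (fromCols f.f₀ᵀ g.f₀ᵀ) V.HXᵀ
  HX := fromCols (fromBlocks C.HX 0 0 D.HX) (fromRows f.fm g.fm)
  comm := by
    have hf : f.fm * V.HX + f.fm * V.HX = 0 := by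
      rw [← two_nsmul]; ext i j; simp [show (2 : ZMod 2) = 0 from rfl]
    have hg : g.fm * V.HX + g.fm * V.HX = 0 := by
      rw [← two_nsmul]; ext i j; simp [show (2 : ZMod 2) = 0 from rfl]
    simp only [Matrix.fromBlocks_transpose, Matrix.fromCols_mul_fromBlocks,
      Matrix.transpose_zero, Matrix.transpose_transpose, Matrix.transpose_fromCols,
      Matrix.fromBlocks_multiply, Matrix.fromBlocks_mul_fromRows, Matrix.fromRows_mul,
      Matrix.mul_zero, Matrix.zero_mul, add_zero, zero_add, C.comm, D.comm,
      ← f.comm₀, ← g.comm₀]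
    ext (i | i) ((j | j) | j)
    all_goals first
      | simp; done
      | simpa using congrFun (congrFun hf i) j
      | simpa using congrFun (congrFun hg i) j

/-- The chain map `C ⊕ D → T` given by the inclusions. Read in the opposite direction it is the
`X`-preserving code map from `T` to `C ⊕ D`. -/
def sandwichMap [DecidableEq Z₁] [DecidableEq Q₁] [DecidableEq X₁]
    [DecidableEq Z₂] [DecidableEq Q₂] [DecidableEq X₂]
    (V : CSSCode Empty V₀ Vm) (C : CSSCode Z₁ Q₁ X₁) (D : CSSCode Z₂ Q₂ X₂)
    (f : CodeMap V C) (g : CodeMap V D) :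
    CodeMap (C.directSum D) (sandwich V C D f g) where
  f₁ := fromRows 1 0
  f₀ := fromRows 1 0
  fm := 1
  comm₁ := by
    simp [sandwich, CSSCode.directSum, Matrix.fromBlocks_transpose, Matrix.fromRows_mul,
      Matrix.fromBlocks_mul_fromRows]
  comm₀ := by
    simp [sandwich, CSSCode.directSum, Matrix.fromCols_mul_fromRows]

/-- The middle code `W = P ⊗ V`, where `P` is `𝔽₂ --(1,1)ᵀ--> 𝔽₂²`:
`W₁ = V₀`, `W₀ = (V₀ ⊕ V₀) ⊕ V₋₁`, `W₋₁ = V₋₁ ⊕ V₋₁`. -/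
def sandwichMiddle [DecidableEq V₀] [DecidableEq Vm] (V : CSSCode Empty V₀ Vm) :
    CSSCode V₀ ((V₀ ⊕ V₀) ⊕ Vm) (Vm ⊕ Vm) where
  HZ := fromCols (fromCols 1 1) V.HXᵀ
  HX := fromCols (fromBlocks V.HX 0 0 V.HX) (fromRows 1 1)
  comm := by
    have h : V.HX + V.HX = 0 := by
      rw [← two_nsmul]; ext i j; simp [show (2 : ZMod 2) = 0 from rfl]
    simp only [Matrix.transpose_fromCols, Matrix.fromCols_mul_fromRows,
      Matrix.fromBlocks_mul_fromRows, Matrix.fromRows_mul, Matrix.transpose_transpose,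
      Matrix.transpose_one, Matrix.mul_one, Matrix.one_mul, add_zero, zero_add]
    ext (i | i) j <;> simpa using congrFun (congrFun h i) j

/-- The inclusion of `V` at the first end of `W`. -/
def middleLeft [DecidableEq V₀] [DecidableEq Vm] (V : CSSCode Empty V₀ Vm) :
    CodeMap V (sandwichMiddle V) where
  f₁ := 0
  f₀ := fromRows (fromRows 1 0) 0
  fm := fromRows 1 0
  comm₁ := by ext i j; exact j.elim
  comm₀ := by
    simp [sandwichMiddle, Matrix.fromCols_mul_fromRows, Matrix.fromBlocks_mul_fromRows,
      Matrix.fromRows_mul]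

/-- The inclusion of `V` at the second end of `W`. -/
def middleRight [DecidableEq V₀] [DecidableEq Vm] (V : CSSCode Empty V₀ Vm) :
    CodeMap V (sandwichMiddle V) where
  f₁ := 0
  f₀ := fromRows (fromRows 0 1) 0
  fm := fromRows 0 1
  comm₁ := by ext i j; exact j.elim
  comm₀ := by
    simp [sandwichMiddle, Matrix.fromCols_mul_fromRows, Matrix.fromBlocks_mul_fromRows,
      Matrix.fromRows_mul]

/-- The map from the middle code to the sandwiched code. -/
def middleToSandwich [DecidableEq V₀] [DecidableEq Vm]
    (V : CSSCode Empty V₀ Vm) (C : CSSCode Z₁ Q₁ X₁) (D : CSSCode Z₂ Q₂ X₂)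
    (f : CodeMap V C) (g : CodeMap V D) :
    CodeMap (sandwichMiddle V) (sandwich V C D f g) where
  f₁ := fromRows 0 1
  f₀ := fromBlocks (fromBlocks f.f₀ 0 0 g.f₀) 0 0 1
  fm := fromBlocks f.fm 0 0 g.fm
  comm₁ := by
    simp [sandwich, sandwichMiddle, Matrix.fromBlocks_transpose, Matrix.transpose_fromCols,
      Matrix.fromBlocks_mul_fromRows]
  comm₀ := by
    simp [sandwich, sandwichMiddle, Matrix.mul_fromCols, Matrix.fromBlocks_multiply,
      Matrix.fromBlocks_mul_fromRows, Matrix.fromCols_mul_fromBlocks, f.comm₀, g.comm₀]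

/-- The sandwiched code is the colimit of `C ← V → W ← V → D`, that is, the pushout of
`D ← V → R` where `R` is the pushout of `W ← V → C`. -/
theorem sandwich_isColimit [DecidableEq Z₁] [DecidableEq Q₁] [DecidableEq X₁]
    [DecidableEq Z₂] [DecidableEq Q₂] [DecidableEq X₂] [DecidableEq V₀] [DecidableEq Vm]
    (V : CSSCode Empty V₀ Vm) (C : CSSCode Z₁ Q₁ X₁) (D : CSSCode Z₂ Q₂ X₂)
    (f : CodeMap V C) (g : CodeMap V D) :
    let toC := (sandwichMap V C D f g).comp (CodeMap.inl C D)
    let toD := (sandwichMap V C D f g).comp (CodeMap.inr C D)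
    let toW := middleToSandwich V C D f g
    toC.comp f = toW.comp (middleLeft V) ∧ toD.comp g = toW.comp (middleRight V) ∧
    ∀ {Z' Q' X' : Type*} [Fintype Z'] [Fintype Q'] [Fintype X'] (E : CSSCode Z' Q' X')
      (a : CodeMap C E) (b : CodeMap D E) (w : CodeMap (sandwichMiddle V) E),
      a.comp f = w.comp (middleLeft V) → b.comp g = w.comp (middleRight V) →
      ∃! h : CodeMap (sandwich V C D f g) E,
        h.comp toC = a ∧ h.comp toD = b ∧ h.comp toW = w := by
  intro toC toD toW
  have hE : ∀ {m : Type _} (A B : Matrix m Empty (ZMod 2)), A = B := fun A B => by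
    ext i j; exact j.elim
  refine ⟨CodeMap.ext (hE _ _) ?_ ?_, CodeMap.ext (hE _ _) ?_ ?_, ?_⟩
  · simp [toC, toW, CodeMap.comp, sandwichMap, CodeMap.inl, middleToSandwich, middleLeft,
      Matrix.fromRows_mul, Matrix.fromBlocks_mul_fromRows]
  · simp [toC, toW, CodeMap.comp, sandwichMap, CodeMap.inl, middleToSandwich, middleLeft,
      Matrix.fromRows_mul, Matrix.fromBlocks_mul_fromRows]
  · simp [toD, toW, CodeMap.comp, sandwichMap, CodeMap.inr, middleToSandwich, middleRight,
      Matrix.fromRows_mul, Matrix.fromBlocks_mul_fromRows]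
  · simp [toD, toW, CodeMap.comp, sandwichMap, CodeMap.inr, middleToSandwich, middleRight,
      Matrix.fromRows_mul, Matrix.fromBlocks_mul_fromRows]
  intro Z' Q' X' _ _ _ E a b w ha hb
  obtain ⟨w₁, w₀, wm, hw₁, hw₀⟩ := w
  obtain ⟨w₀, r, rfl⟩ : ∃ p q, w₀ = fromCols p q := ⟨_, _, (fromCols_toCols w₀).symm⟩
  obtain ⟨p, q, rfl⟩ : ∃ p q, w₀ = fromCols p q := ⟨_, _, (fromCols_toCols w₀).symm⟩
  obtain ⟨m, n, rfl⟩ : ∃ p q, wm = fromCols p q := ⟨_, _, (fromCols_toCols wm).symm⟩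
  have ha₀ := congrArg CodeMap.f₀ ha
  have ham := congrArg CodeMap.fm ha
  have hb₀ := congrArg CodeMap.f₀ hb
  have hbm := congrArg CodeMap.fm hb
  simp only [CodeMap.comp, middleLeft, middleRight, Matrix.fromCols_mul_fromRows, Matrix.mul_one,
    Matrix.mul_zero, add_zero, zero_add] at ha₀ ham hb₀ hbm
  subst ha₀ ham hb₀ hbm
  simp only [sandwichMiddle, Matrix.transpose_fromCols, Matrix.fromCols_mul_fromRows,
    Matrix.transpose_one, Matrix.transpose_transpose, Matrix.mul_one] at hw₁
  simp only [sandwichMiddle, Matrix.mul_fromCols, Matrix.fromCols_mul_fromBlocks,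
    Matrix.fromCols_mul_fromRows, Matrix.mul_one, Matrix.mul_zero, add_zero, zero_add,
    Matrix.fromCols_inj.eq_iff] at hw₀
  refine ⟨{ f₁ := fromCols (fromCols a.f₁ b.f₁) w₁
            f₀ := fromCols (fromCols a.f₀ b.f₀) r
            fm := fromCols a.fm b.fm
            comm₁ := ?_
            comm₀ := ?_ }, ⟨?_, ?_, ?_⟩, ?_⟩
  · simp only [sandwich, Matrix.fromBlocks_transpose, Matrix.fromCols_mul_fromBlocks,
      Matrix.mul_fromCols, Matrix.transpose_zero, Matrix.transpose_fromCols,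
      Matrix.transpose_transpose, Matrix.fromCols_mul_fromRows, Matrix.mul_zero, add_zero,
      zero_add, a.comm₁, b.comm₁, hw₁]
  · simp only [sandwich, Matrix.fromCols_mul_fromBlocks,
      Matrix.mul_fromCols, Matrix.fromCols_mul_fromRows, Matrix.mul_zero, add_zero,
      zero_add, a.comm₀, b.comm₀, hw₀.2]
  · ext1 <;> simp [toC, CodeMap.comp, sandwichMap, CodeMap.inl, Matrix.fromCols_mul_fromRows,
      Matrix.fromRows_mul]
  · ext1 <;> simp [toD, CodeMap.comp, sandwichMap, CodeMap.inr, Matrix.fromCols_mul_fromRows,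
      Matrix.fromRows_mul]
  · ext1 <;> simp [toW, CodeMap.comp, middleToSandwich, Matrix.fromCols_mul_fromRows,
      Matrix.fromCols_mul_fromBlocks]
  · rintro ⟨h₁, h₀, hm, c₁, c₀⟩ ⟨e₁, e₂, e₃⟩
    obtain ⟨h₁, k, rfl⟩ : ∃ p q, h₁ = fromCols p q := ⟨_, _, (fromCols_toCols h₁).symm⟩
    obtain ⟨h₁, h₁', rfl⟩ : ∃ p q, h₁ = fromCols p q := ⟨_, _, (fromCols_toCols h₁).symm⟩
    obtain ⟨h₀, t, rfl⟩ : ∃ p q, h₀ = fromCols p q := ⟨_, _, (fromCols_toCols h₀).symm⟩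
    obtain ⟨h₀, h₀', rfl⟩ : ∃ p q, h₀ = fromCols p q := ⟨_, _, (fromCols_toCols h₀).symm⟩
    obtain ⟨hm, hm', rfl⟩ : ∃ p q, hm = fromCols p q := ⟨_, _, (fromCols_toCols hm).symm⟩
    simp only [CodeMap.ext_iff, toC, toD, toW, CodeMap.comp, sandwichMap, CodeMap.inl,
      CodeMap.inr, middleToSandwich, Matrix.fromCols_mul_fromRows, Matrix.fromRows_mul,
      Matrix.fromCols_mul_fromBlocks, Matrix.one_mul, Matrix.mul_one, Matrix.mul_zero,
      Matrix.zero_mul, add_zero, zero_add, Matrix.fromCols_inj.eq_iff] at e₁ e₂ e₃ ⊢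
    simp [e₁, e₂, e₃]

end Sandwich

section Quantum

/-- Vectors in the Hilbert space `(ℂ²)^{⊗ Q}` of the qubits `Q`, in the computational basis. -/
abbrev QState (Q : Type*) : Type _ := (Q → ZMod 2) → ℂ

/-- `(-1)^a`. -/
def sgn (a : ZMod 2) : ℂ := if a = 0 then 1 else -1

/-- An `n`-qubit Pauli operator `Z^z X^x` (up to a phase). -/
structure Pauli (Q : Type*) where
  x : Q → ZMod 2
  z : Q → ZMod 2

/-- The number of qubits on which a Pauli operator acts as `X`, `Y` or `Z`. -/
def Pauli.weight {Q : Type*} [Fintype Q] (P : Pauli Q) : ℕ :=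
  (Finset.univ.filter fun q => P.x q ≠ 0 ∨ P.z q ≠ 0).card

/-- The action `|b⟩ ↦ (-1)^{z·(b + x)} |b + x⟩` of a Pauli operator on states. -/
def Pauli.act {Q : Type*} [Fintype Q] (P : Pauli Q) (ψ : QState Q) : QState Q :=
  fun b => sgn (P.z ⬝ᵥ b) * ψ (b + P.x)

/-- The interpretation as a `ℂ`-linear map of the `X`-preserving code map that is given by
(the degree-0 part of) a chain map, a matrix `F` from `N` to `K`: it goes in the opposite
direction, `|b⟩ ↦ |Fᵀ b⟩`, so that it takes `X^b` to `X^{Fᵀ b}`, and takes `Z^{F a}` to `Z^a`.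
It is used for the matrix of `H₀(f)`, giving the map on logical qubits. -/
noncomputable def interpX {K N : Type*} [Fintype K] [DecidableEq K] [Fintype N]
    (F : Matrix K N (ZMod 2)) (φ : QState K) : QState N :=
  fun a => ∑ b : K → ZMod 2, if Fᵀ *ᵥ b = a then φ b else 0

/-- The map of the `X`-split on the merged logical qubit and the identity on all others:
`|0⟩ ↦ |00⟩`, `|1⟩ ↦ |11⟩` from the logical qubit `Sum.inl i₀` to the pair
`Sum.inl i₀`, `Sum.inr j₀`. -/
def splitMap {I J : Type*} (i₀ : I) (j₀ : J)
    (φ : QState {k : I ⊕ J // k ≠ Sum.inr j₀}) : QState (I ⊕ J) :=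
  fun a => if a (Sum.inl i₀) = a (Sum.inr j₀) then φ (fun k => a k.1) else 0

/-- The identification `j₀ ↦ i₀` of the two logical qubits that are merged. -/
def mergeIndex {I J : Type*} [DecidableEq I] [DecidableEq J] (i₀ : I) (j₀ : J) (k : I ⊕ J) :
    {k : I ⊕ J // k ≠ Sum.inr j₀} :=
  if h : k = Sum.inr j₀ then ⟨Sum.inl i₀, Sum.inl_ne_inr⟩ else ⟨k, h⟩

variable {Z Q X : Type*} [Fintype Z] [Fintype Q] [Fintype X] [DecidableEq X]

/-- The (unnormalised) encoder of a based CSS code. A logical computational basis state `|a⟩` is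
sent to the sum of all `|y⟩` with `y` an undetectable `X`-operator whose pairing with the `k`-th
basis element of `H₀` is `a k`. This is a sum over a coset of the products of `X`-type
generators, namely the class with coordinates `a` in the dual basis of logical
`X`-operators. Its image is the code space. -/
noncomputable def CSSCode.encode {N : Type*} (C : CSSCode Z Q X) (u : Module.Basis N (ZMod 2) C.H0)
    (φ : QState N) : QState Q :=
  fun y => if h : C.HZ *ᵥ y = 0 then φ (fun k => C.pairing y h (u k)) else 0

/-- The projector on the joint eigenspace of all `X`-type generators with outcomes
`(-1)^{σ i}`: the product over the generators `g_i` of `(1 + (-1)^{σ i} g_i) / 2`, expanded. -/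
noncomputable def CSSCode.projX (C : CSSCode Z Q X) (σ : X → ZMod 2) (ψ : QState Q) : QState Q :=
  fun b => (2⁻¹ : ℂ) ^ Fintype.card X *
    ∑ l : X → ZMod 2, sgn (l ⬝ᵥ σ) * ψ (b + C.HXᵀ *ᵥ l)

/-- The projector on the joint eigenspace of all `Z`-type generators with outcomes
`(-1)^{σ i}`. -/
def CSSCode.projZ (C : CSSCode Z Q X) (σ : Z → ZMod 2) (ψ : QState Q) : QState Q :=
  fun b => if C.HZ *ᵥ b = σ then ψ b else 0

/-- The Kraus operator of measuring out the qubits `A` in the `X`-basis with outcomes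
`(-1)^{s a}`: the effect `⟨+|` or `⟨-|` on each qubit of `A`. -/
noncomputable def measureOutX {A : Type*} [Fintype A] [DecidableEq A] (s : A → ZMod 2)
    (ψ : QState (Q ⊕ A)) : QState Q :=
  fun b => ((Real.sqrt 2 : ℝ) : ℂ)⁻¹ ^ Fintype.card A *
    ∑ c : A → ZMod 2, sgn (s ⬝ᵥ c) * ψ (Sum.elim b c)

/-- Measuring out the qubits `A` with all outcomes `+1` is, up to normalisation, the interpretation
of the inclusion of the qubits `Q` (as in `sandwichMap`) on physical qubits. -/
theorem measureOutX_zero [DecidableEq Q] {A : Type*} [Fintype A] [DecidableEq A]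
    (ψ : QState (Q ⊕ A)) :
    measureOutX 0 ψ = (((Real.sqrt 2 : ℝ) : ℂ)⁻¹ ^ Fintype.card A) •
      interpX (fromRows (1 : Matrix Q Q (ZMod 2)) (0 : Matrix A Q (ZMod 2))) ψ := by
  ext b
  simp only [measureOutX, interpX, Pi.smul_apply, smul_eq_mul]
  congr 1
  rw [← (Equiv.sumArrowEquivProdArrow Q A (ZMod 2)).symm.sum_comp, Fintype.sum_prod_type]
  simp [transpose_fromRows, fromCols_mulVec, sgn, Equiv.sumArrowEquivProdArrow, Function.comp_def]

/-- The classical record of the split procedure with `R` rounds: the reported `X`-outcomes of the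
qubits `A` that are measured out, and the reported syndromes of the `R` rounds in which all
generators (`X`-type and `Z`-type) are measured. -/
structure SplitRecord (R : ℕ) (A Z X : Type*) where
  out : A → ZMod 2
  synX : Fin R → X → ZMod 2
  synZ : Fin R → Z → ZMod 2

/-- A pattern of faults in the split procedure with `R` rounds: a Pauli error `input` on the
incoming state, flips of reported outcomes, and a Pauli error on the data qubits before each of
the `R` rounds and after the last one. -/
structure SplitFaults (R : ℕ) (Q A Z X : Type*) where
  input : Pauli (Q ⊕ A)
  flipOut : A → ZMod 2
  data : Fin (R + 1) → Pauli Q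
  flipX : Fin R → X → ZMod 2
  flipZ : Fin R → Z → ZMod 2

/-- No faults. -/
def SplitFaults.none (R : ℕ) (Q A Z X : Type*) : SplitFaults R Q A Z X :=
  ⟨⟨0, 0⟩, 0, fun _ => ⟨0, 0⟩, 0, 0⟩

/-- The number of faults that occur during the procedure: flipped outcomes and
single-qubit Pauli errors. (Errors of the incoming state are counted separately.) -/
def SplitFaults.number {R : ℕ} {A : Type*} [Fintype A] (F : SplitFaults R Q A Z X) : ℕ :=
  hammingNorm F.flipOut + ∑ k, (F.data k).weight +
    ∑ k, (hammingNorm (F.flipX k) + hammingNorm (F.flipZ k))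

/-- The split procedure with `R` rounds and with classical decoder `dec`, in the branch with
reported record `rec` and under the faults `F`, as a Kraus operator on the incoming state of the
qubits `Q ⊕ A`:
the qubits `A` are measured out in the `X`-basis, then all generators of `C` are measured `R`
times, then the Pauli correction `dec rec` is applied. The reported outcomes are the true ones
plus the flips, so the true ones are the reported ones plus the flips. -/
noncomputable def CSSCode.runSplit {A : Type*} [Fintype A] [DecidableEq A] (C : CSSCode Z Q X)
    {R : ℕ} (dec : SplitRecord R A Z X → Pauli Q) (F : SplitFaults R Q A Z X)
    (rec : SplitRecord R A Z X) (ψ : QState (Q ⊕ A)) : QState Q :=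
  (dec rec).act <| (F.data (Fin.last R)).act <|
    Fin.foldl R
      (fun χ k => C.projZ (rec.synZ k + F.flipZ k) <| C.projX (rec.synX k + F.flipX k) <|
        (F.data k.castSucc).act χ)
      (measureOutX (rec.out + F.flipOut) (F.input.act ψ))

/-- Without faults, in every branch, the split procedure takes an encoded state `encIn φ` to the
encoded state `encOut (L φ)`, with an amplitude that does not depend on `φ`: it implements the
logical map `L`, deterministically. -/
def CSSCode.SplitImplements {A K N : Type*} [Fintype A] [DecidableEq A] (C : CSSCode Z Q X)
    {R : ℕ} (dec : SplitRecord R A Z X → Pauli Q) (encIn : QState K → QState (Q ⊕ A))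
    (encOut : QState N → QState Q) (L : QState K → QState N) : Prop :=
  ∀ rec, ∃ c : ℂ, ∀ φ,
    C.runSplit dec (SplitFaults.none R Q A Z X) rec (encIn φ) = c • encOut (L φ)

/-- The split procedure is a fault-tolerant implementation of the logical map `L` with
distance `d`. Let the incoming encoded state have a Pauli error of weight `r` and let `s` faults
occur during the procedure. If `2 (r + s) < d`, or if `r + s < d` and the faults are undetected
(the record is one that can occur without faults), then the result is the encoded state
`encOut (L φ)` up to a Pauli error of weight at most `s`. -/
def CSSCode.SplitFaultTolerant {A K N : Type*} [Fintype A] [DecidableEq A] (C : CSSCode Z Q X)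
    {R : ℕ} (dec : SplitRecord R A Z X → Pauli Q) (encIn : QState K → QState (Q ⊕ A))
    (encOut : QState N → QState Q) (L : QState K → QState N) (d : ℕ) : Prop :=
  ∀ (F : SplitFaults R Q A Z X) (rec : SplitRecord R A Z X),
    (2 * (F.input.weight + F.number) < d ∨
      (F.input.weight + F.number < d ∧
        ∃ φ, C.runSplit dec (SplitFaults.none R Q A Z X) rec (encIn φ) ≠ 0)) →
    ∃ (E : Pauli Q) (c : ℂ), E.weight ≤ F.number ∧
      ∀ φ, C.runSplit dec F rec (encIn φ) = c • E.act (encOut (L φ))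

end Quantum

/-!
Write `E = C ⊕ D`, `K = (f₀, g₀) : V₀ → E₀` and `∂ = V.HX`, which is onto.

*Homology.* As `∂` is onto, every cycle of the sandwiched code `T` can be pushed off the
intermediate qubits, so `H₀(ι)` is onto. A cycle of `E` becomes a boundary in `T` exactly if it is
homologous to `K κ` for some `κ ∈ ker ∂`, and by separation the class of `K κ` is `0` or
`[u] + [v]`. Both occur, since the sum `1` of all basis vectors of `V₀` lies in `ker ∂` and has
`K 1 = u + v`. So the kernel of `H₀(ι)` is spanned by `[u] + [v]`, and the images of the basis
elements other than `[v]` form a basis (`IsSeparated.exists_basis`).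

*Measuring out.* A computational basis state `|y, c⟩` occurs in an encoded state of `T` only if
`∂ᵀ c = Kᵀ y`. This determines `c`, and it is solvable if and only if `Kᵀ y` vanishes on `ker ∂`,
that is, if and only if the logical qubits `i₀` and `j₀` of `y` agree. Outcomes `s = ∂ t` therefore
produce the split state with the `Z`-operator `K t` applied (`IsSeparated.measureOutX_encode`).

*Fault tolerance.* From then on the state is a code state of `E` with a Pauli operator applied, and
the records that can occur are among those in which every round reports the syndrome of the
accumulated Pauli operator plus the flips (`CSSCode.exists_runSplit_eq_smul`). The decoder picks
an explanation of the record: no faults if that is possible, and otherwise a consistent fault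
pattern `F'` with `2 (r' + s') < d` and with `s'` minimal. It undoes only the error that `F'` has
right after measuring out. Let `F` be the true fault pattern. The two patterns have fewer than
`d ≤ R` faults in total, so they have a round `k` without flips in common
(`SplitFaults.exists_flip_eq_zero`), where their accumulated errors differ by an undetectable
operator of weight less than `d`. Such an operator acts trivially: its `X`-part by the distance of
`E`, and its `Z`-part, taken together with the flips of the outcomes of the intermediate qubits, by
`d^Z` of `T` (`IsSeparated.act_z_eq_self`). Hence the remaining error consists of the data errors
of `F` after round `k` and those of `F'` before. By minimality `F'` has at most as many faults
up to round `k` as `F` (`SplitFaults.numberUpTo_le_of_minimal`; clear if `F'` has none):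
otherwise, following `F` up to round `k` and `F'` afterwards would be a better explanation. So
the remaining error has weight at most `s`.
-/

/-! ### Pauli operators modulo phase -/

theorem sgn_add (a b : ZMod 2) : sgn (a + b) = sgn a * sgn b := by
  unfold sgn
  have h : ∀ a : ZMod 2, a = 0 ∨ a = 1 := by decide
  obtain rfl | rfl := h a <;> obtain rfl | rfl := h b <;> simp [CharTwo.add_self_eq_zero]

@[simp] theorem sgn_zero : sgn 0 = 1 := if_pos rfl

theorem sgn_mul_self (a : ZMod 2) : sgn a * sgn a = 1 := by
  rw [← sgn_add, CharTwo.add_self_eq_zero, sgn_zero]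

/-- Orthogonality of the characters of `𝔽₂ⁿ`. -/
theorem sum_sgn_dotProduct {X : Type*} [Fintype X] [DecidableEq X] (m : X → ZMod 2) :
    ∑ l : X → ZMod 2, sgn (l ⬝ᵥ m) = if m = 0 then 2 ^ Fintype.card X else 0 := by
  split_ifs with h
  · subst h
    simp [ZMod.card]
  · obtain ⟨i, hi⟩ := Function.ne_iff.mp h
    -- Translation by the `i`-th unit vector flips the sign of every term.
    have key : ∑ l : X → ZMod 2, sgn (l ⬝ᵥ m) = -∑ l : X → ZMod 2, sgn (l ⬝ᵥ m) := by
      rw [← Finset.sum_neg_distrib]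
      rw [← Equiv.sum_comp (Equiv.addRight (Pi.single i 1 : X → ZMod 2))]
      refine Finset.sum_congr rfl fun l _ => ?_
      rw [Equiv.coe_addRight, add_dotProduct, sgn_add, single_one_dotProduct]
      have : sgn (m i) = -1 := if_neg hi
      rw [this, mul_neg_one]
    exact self_eq_neg.mp key

namespace Pauli

variable {Q : Type*}

theorem eq_of_parts {P P' : Pauli Q} (hx : P.x = P'.x) (hz : P.z = P'.z) : P = P' := by
  cases P; cases P'; simp_all

/-- Multiplication of Pauli operators modulo phase, written additively. -/
instance : Add (Pauli Q) := ⟨fun P P' => ⟨P.x + P'.x, P.z + P'.z⟩⟩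

instance : Zero (Pauli Q) := ⟨⟨0, 0⟩⟩

@[simp] theorem add_x (P P' : Pauli Q) : (P + P').x = P.x + P'.x := rfl
@[simp] theorem add_z (P P' : Pauli Q) : (P + P').z = P.z + P'.z := rfl
@[simp] theorem zero_x : (0 : Pauli Q).x = 0 := rfl
@[simp] theorem zero_z : (0 : Pauli Q).z = 0 := rfl

instance : AddCommMonoid (Pauli Q) where
  add_assoc _ _ _ := eq_of_parts (add_assoc _ _ _) (add_assoc _ _ _)
  zero_add _ := eq_of_parts (zero_add _) (zero_add _)
  add_zero _ := eq_of_parts (add_zero _) (add_zero _)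
  add_comm _ _ := eq_of_parts (add_comm _ _) (add_comm _ _)
  nsmul := nsmulRec

theorem add_self (P : Pauli Q) : P + P = 0 :=
  eq_of_parts (ZModModule.add_self _) (ZModModule.add_self _)

variable [Fintype Q]

theorem act_zero (ψ : QState Q) : (0 : Pauli Q).act ψ = ψ := by
  ext b
  simp [act]

theorem act_act (P P' : Pauli Q) (ψ : QState Q) :
    P.act (P'.act ψ) = sgn (P'.z ⬝ᵥ P.x) • (P + P').act ψ := by
  ext b
  simp only [act, Pi.smul_apply, smul_eq_mul, add_x, add_z, dotProduct_add, add_dotProduct,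
    sgn_add, add_assoc]
  ring

theorem act_smul (P : Pauli Q) (c : ℂ) (ψ : QState Q) : P.act (c • ψ) = c • P.act ψ := by
  ext b
  simp only [act, Pi.smul_apply, smul_eq_mul]
  ring

theorem act_eq_act_act (P : Pauli Q) (ψ : QState Q) :
    P.act ψ = act ⟨0, P.z⟩ (act ⟨P.x, 0⟩ ψ) := by
  ext b
  simp [act]

@[simp] theorem weight_zero : (0 : Pauli Q).weight = 0 := by
  simp [weight]

theorem weight_add_le (P P' : Pauli Q) : (P + P').weight ≤ P.weight + P'.weight := by
  classical
  refine (Finset.card_le_card ?_).trans (Finset.card_union_le _ _)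
  intro q
  simp only [Finset.mem_filter, Finset.mem_univ, true_and, Finset.mem_union, add_x, add_z,
    Pi.add_apply]
  contrapose!
  rintro ⟨⟨h₁, h₂⟩, h₃, h₄⟩
  simp [h₁, h₂, h₃, h₄]

theorem weight_sum_le {ι : Type*} (s : Finset ι) (P : ι → Pauli Q) :
    (∑ j ∈ s, P j).weight ≤ ∑ j ∈ s, (P j).weight :=
  Finset.le_sum_of_subadditive _ weight_zero.le weight_add_le s P

theorem hammingNorm_x_le (P : Pauli Q) : hammingNorm P.x ≤ P.weight :=
  Finset.card_le_card fun q => by simp +contextual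

theorem hammingNorm_z_le (P : Pauli Q) : hammingNorm P.z ≤ P.weight :=
  Finset.card_le_card fun q => by simp +contextual

end Pauli

theorem hammingNorm_add_le {A : Type*} [Fintype A] (x y : A → ZMod 2) :
    hammingNorm (x + y) ≤ hammingNorm x + hammingNorm y := by
  have h := hammingDist_triangle (-x) 0 y
  rwa [hammingDist_eq_hammingNorm, hammingDist_eq_hammingNorm, hammingDist_zero_left, neg_neg,
    add_zero] at h

theorem hammingNorm_sum_elim {A B : Type*} [Fintype A] [Fintype B] (x : A → ZMod 2)
    (y : B → ZMod 2) : hammingNorm (Sum.elim x y) = hammingNorm x + hammingNorm y := by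
  simp only [hammingNorm, Finset.card_filter, Fintype.sum_sum_type]
  rfl

/-! ### Measurements of a code state with a Pauli error -/

namespace CSSCode

variable {Z Q X : Type*} [Fintype Z] [Fintype Q] [Fintype X]

/-- The states of the code space: joint `+1` eigenstates of all generators. -/
structure IsCodeState (C : CSSCode Z Q X) (χ : QState Q) : Prop where
  mulVec_eq_zero : ∀ b, χ b ≠ 0 → C.HZ *ᵥ b = 0
  add_mulVec : ∀ b l, χ (b + C.HXᵀ *ᵥ l) = χ b

variable {C : CSSCode Z Q X}

theorem projX_smul (σ : X → ZMod 2) (c : ℂ) (ψ : QState Q) [DecidableEq X] :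
    C.projX σ (c • ψ) = c • C.projX σ ψ := by
  ext b
  simp only [projX, Pi.smul_apply, smul_eq_mul, Finset.mul_sum]
  exact Finset.sum_congr rfl fun _ _ => by ring

theorem projZ_smul (σ : Z → ZMod 2) (c : ℂ) (ψ : QState Q) :
    C.projZ σ (c • ψ) = c • C.projZ σ ψ := by
  ext b
  simp [projZ]

theorem IsCodeState.projX_act [DecidableEq X] {χ : QState Q} (hχ : C.IsCodeState χ)
    (σ : X → ZMod 2) (P : Pauli Q) :
    C.projX σ (P.act χ) = if σ = C.HX *ᵥ P.z then P.act χ else 0 := by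
  ext b
  have h (l : X → ZMod 2) : sgn (l ⬝ᵥ σ) * P.act χ (b + C.HXᵀ *ᵥ l) =
      P.act χ b * sgn (l ⬝ᵥ (σ + C.HX *ᵥ P.z)) := by
    have h₁ : P.z ⬝ᵥ C.HXᵀ *ᵥ l = l ⬝ᵥ C.HX *ᵥ P.z := by
      rw [mulVec_transpose, dotProduct_comm, ← dotProduct_mulVec]
    simp only [Pauli.act, add_right_comm b, hχ.add_mulVec, dotProduct_add, sgn_add, h₁]
    ring
  simp only [projX, h, ← Finset.mul_sum, sum_sgn_dotProduct]
  by_cases hσ : σ = C.HX *ᵥ P.z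
  · rw [if_pos hσ, if_pos (by rw [hσ, ZModModule.add_self])]
    rw [mul_comm, mul_assoc, ← mul_pow]
    simp
  · rw [if_neg hσ, if_neg]
    · simp
    · exact fun h => hσ (by simpa using funext fun i => CharTwo.add_eq_zero.mp (congrFun h i))

theorem IsCodeState.projZ_act {χ : QState Q} (hχ : C.IsCodeState χ) (σ : Z → ZMod 2)
    (P : Pauli Q) :
    C.projZ σ (P.act χ) = if σ = C.HZ *ᵥ P.x then P.act χ else 0 := by
  ext b
  by_cases hb : χ (b + P.x) = 0
  · simp [projZ, Pauli.act, hb, ite_apply]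
  · have h₁ := hχ.mulVec_eq_zero _ hb
    have h₂ : C.HZ *ᵥ b = C.HZ *ᵥ P.x := by
      rw [mulVec_add] at h₁
      exact funext fun i => CharTwo.add_eq_zero.mp (congrFun h₁ i)
    simp only [projZ, h₂, ite_apply, Pi.zero_apply, eq_comm]

/-- Repeated syndrome measurement of a code state with Pauli errors `P₀` and, before each round
`k`, `e k`: either the outcomes are the syndromes of the accumulated errors, or the branch has
amplitude zero; the amplitude is the same for all code states. -/
theorem exists_foldl_proj_eq_smul [DecidableEq X] (C : CSSCode Z Q X) :
    ∀ (R : ℕ) (e : Fin R → Pauli Q) (σX : Fin R → X → ZMod 2) (σZ : Fin R → Z → ZMod 2)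
      (P₀ : Pauli Q), ∃ c : ℂ,
      (c ≠ 0 → ∀ k, σX k = C.HX *ᵥ (P₀ + ∑ j, if j ≤ k then e j else 0).z ∧
        σZ k = C.HZ *ᵥ (P₀ + ∑ j, if j ≤ k then e j else 0).x) ∧
      ∀ χ, C.IsCodeState χ →
        Fin.foldl R (fun χ k => C.projZ (σZ k) (C.projX (σX k) ((e k).act χ))) (P₀.act χ) =
          c • (P₀ + ∑ j, e j).act χ
  | 0, e, σX, σZ, P₀ => ⟨1, fun _ k => k.elim0, fun χ _ => by simp⟩
  | R + 1, e, σX, σZ, P₀ => by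
    obtain ⟨c, hc, h⟩ := exists_foldl_proj_eq_smul C R (fun k => e k.castSucc)
      (fun k => σX k.castSucc) (fun k => σZ k.castSucc) P₀
    have hsum (k : Fin R) : (∑ j, if j ≤ k.castSucc then e j else 0) =
        ∑ j, if j ≤ k then e j.castSucc else 0 := by
      rw [Fin.sum_univ_castSucc]
      simp
    have hlast : (∑ j, if j ≤ Fin.last R then e j else 0) = ∑ j, e j :=
      Finset.sum_congr rfl fun j _ => if_pos (Fin.le_last j)
    have htot : e (Fin.last R) + (P₀ + ∑ j : Fin R, e j.castSucc) = P₀ + ∑ j, e j := by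
      rw [Fin.sum_univ_castSucc, add_comm, add_assoc]
    by_cases hk : σX (Fin.last R) = C.HX *ᵥ (P₀ + ∑ j, e j).z ∧
        σZ (Fin.last R) = C.HZ *ᵥ (P₀ + ∑ j, e j).x
    · refine ⟨c * sgn ((P₀ + ∑ j : Fin R, e j.castSucc).z ⬝ᵥ (e (Fin.last R)).x), fun hne => ?_,
        fun χ hχ => ?_⟩
      · refine Fin.lastCases ?_ fun k => ?_
        · rwa [hlast]
        · rw [hsum]
          exact hc (left_ne_zero_of_mul hne) k
      · rw [Fin.foldl_succ_last, h χ hχ, Pauli.act_smul, Pauli.act_act, htot, smul_smul,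
          projX_smul, projZ_smul, hχ.projX_act, if_pos hk.1, hχ.projZ_act, if_pos hk.2]
    · refine ⟨0, fun hne => absurd rfl hne, fun χ hχ => ?_⟩
      rw [Fin.foldl_succ_last, h χ hχ, Pauli.act_smul, Pauli.act_act, htot, smul_smul,
        projX_smul, projZ_smul, hχ.projX_act]
      rw [not_and_or] at hk
      split_ifs with h₁
      · rw [hχ.projZ_act, if_neg (hk.resolve_left (not_not.mpr h₁)), smul_zero, zero_smul]
      · ext b
        simp [projZ]

end CSSCode

/-- A Pauli error on the incoming state commutes with measuring out `A`, up to a sign and up to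
flips of the outcomes by its `Z`-part on `A`. -/
theorem measureOutX_act {Q A : Type*} [Fintype Q] [Fintype A] [DecidableEq A]
    (s : A → ZMod 2) (P : Pauli (Q ⊕ A)) (ψ : QState (Q ⊕ A)) :
    measureOutX s (P.act ψ) =
      sgn ((s + P.z ∘ Sum.inr) ⬝ᵥ (P.x ∘ Sum.inr)) •
        Pauli.act ⟨P.x ∘ Sum.inl, P.z ∘ Sum.inl⟩ (measureOutX (s + P.z ∘ Sum.inr) ψ) := by
  ext b
  have hz (c : A → ZMod 2) : P.z ⬝ᵥ Sum.elim b c =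
      (P.z ∘ Sum.inl) ⬝ᵥ b + (P.z ∘ Sum.inr) ⬝ᵥ c := by
    simp [dotProduct, Fintype.sum_sum_type]
  have hx (c : A → ZMod 2) : Sum.elim b (c + P.x ∘ Sum.inr) + P.x =
      Sum.elim (b + P.x ∘ Sum.inl) c := by
    ext (q | q)
    · simp
    · simp [add_assoc, CharTwo.add_self_eq_zero]
  simp only [measureOutX, Pauli.act, Pi.smul_apply, smul_eq_mul]
  rw [← Equiv.sum_comp (Equiv.addRight (P.x ∘ Sum.inr))]
  simp only [Equiv.coe_addRight, hx, hz, Finset.mul_sum]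
  refine Finset.sum_congr rfl fun c _ => ?_
  simp only [dotProduct_add, add_dotProduct, sgn_add]
  ring

/-! ### Fault patterns -/

namespace SplitFaults

variable {R : ℕ} {Q A Z X : Type*} [Fintype Q] [Fintype A] [Fintype Z] [Fintype X]

/-- The Pauli error right after the qubits `A` are measured out with reported outcomes `out`: the
`Q`-part of the incoming error, and the `Z`-operator `L *ᵥ s` that is due to the effective
outcomes `s` (the reported ones plus the flips plus the incoming `Z`-error on `A`). -/
def initial (L : Matrix Q A (ZMod 2)) (F : SplitFaults R Q A Z X) (out : A → ZMod 2) : Pauli Q :=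
  ⟨F.input.x ∘ Sum.inl, F.input.z ∘ Sum.inl + L *ᵥ (out + F.flipOut + F.input.z ∘ Sum.inr)⟩

/-- The product of the data errors before round `k` is measured. -/
def dataUpTo (F : SplitFaults R Q A Z X) (k : Fin R) : Pauli Q :=
  ∑ j, if j ≤ k.castSucc then F.data j else 0

/-- The product of the data errors after round `k` is measured. -/
def dataAfter (F : SplitFaults R Q A Z X) (k : Fin R) : Pauli Q :=
  ∑ j, if j ≤ k.castSucc then 0 else F.data j

theorem sum_data (F : SplitFaults R Q A Z X) (k : Fin R) :
    ∑ j, F.data j = F.dataUpTo k + F.dataAfter k := by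
  rw [dataUpTo, dataAfter, ← Finset.sum_add_distrib]
  exact Finset.sum_congr rfl fun j _ => by split_ifs <;> simp

/-- The number of faults up to and including round `k`. -/
def numberUpTo (F : SplitFaults R Q A Z X) (k : Fin R) : ℕ :=
  hammingNorm F.flipOut + (∑ j, if j ≤ k.castSucc then (F.data j).weight else 0) +
    ∑ i, if i ≤ k then hammingNorm (F.flipX i) + hammingNorm (F.flipZ i) else 0

/-- The number of faults after round `k`. -/
def numberAfter (F : SplitFaults R Q A Z X) (k : Fin R) : ℕ :=
  (∑ j, if j ≤ k.castSucc then 0 else (F.data j).weight) +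
    ∑ i, if i ≤ k then 0 else hammingNorm (F.flipX i) + hammingNorm (F.flipZ i)

theorem number_eq (F : SplitFaults R Q A Z X) (k : Fin R) :
    F.number = F.numberUpTo k + F.numberAfter k := by
  have h {n : ℕ} (p : Fin n → Prop) [DecidablePred p] (w : Fin n → ℕ) :
      ∑ j, w j = (∑ j, if p j then w j else 0) + ∑ j, if p j then 0 else w j := by
    rw [← Finset.sum_add_distrib]
    exact Finset.sum_congr rfl fun j _ => by split_ifs <;> simp
  rw [number, numberUpTo, numberAfter, h (· ≤ k.castSucc) fun j => (F.data j).weight,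
    h (· ≤ k) fun i => hammingNorm (F.flipX i) + hammingNorm (F.flipZ i)]
  ring

theorem hammingNorm_flipOut_add_weight_dataUpTo_le (F : SplitFaults R Q A Z X) (k : Fin R) :
    hammingNorm F.flipOut + (F.dataUpTo k).weight ≤ F.numberUpTo k := by
  have h : (F.dataUpTo k).weight ≤ ∑ j, if j ≤ k.castSucc then (F.data j).weight else 0 :=
    (Pauli.weight_sum_le _ _).trans (Finset.sum_le_sum fun j _ => by split_ifs <;> simp)
  unfold numberUpTo
  omega

theorem weight_dataAfter_le (F : SplitFaults R Q A Z X) (k : Fin R) :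
    (F.dataAfter k).weight ≤ F.numberAfter k := by
  refine le_trans ((Pauli.weight_sum_le _ _).trans
    (Finset.sum_le_sum fun j _ => ?_)) (Nat.le_add_right _ _)
  split_ifs <;> simp

theorem weight_input_eq (F : SplitFaults R Q A Z X) :
    (⟨F.input.x ∘ Sum.inl, F.input.z ∘ Sum.inl⟩ : Pauli Q).weight +
      (⟨F.input.x ∘ Sum.inr, F.input.z ∘ Sum.inr⟩ : Pauli A).weight = F.input.weight := by
  simp only [Pauli.weight, Finset.card_filter, Fintype.sum_sum_type, Function.comp_apply]

/-- The fault pattern that agrees with `F` up to and including round `k`, and with `F'`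
afterwards. -/
def splice (F F' : SplitFaults R Q A Z X) (k : Fin R) : SplitFaults R Q A Z X where
  input := F.input
  flipOut := F.flipOut
  data j := if j ≤ k.castSucc then F.data j else F'.data j
  flipX i := if i ≤ k then F.flipX i else F'.flipX i
  flipZ i := if i ≤ k then F.flipZ i else F'.flipZ i

theorem number_splice (F F' : SplitFaults R Q A Z X) (k : Fin R) :
    (F.splice F' k).number = F.numberUpTo k + F'.numberAfter k := by
  rw [number_eq _ k]
  congr 1
  · unfold numberUpTo splice
    congr 1
    · congr 1
      exact Finset.sum_congr rfl fun j _ => by split_ifs with hj <;> simp [hj]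
    · exact Finset.sum_congr rfl fun j _ => by split_ifs with hj <;> simp [hj]
  · unfold numberAfter splice
    congr 1 <;> exact Finset.sum_congr rfl fun j _ => by split_ifs with hj <;> simp [hj]

theorem dataUpTo_splice_of_le (F F' : SplitFaults R Q A Z X) {i k : Fin R} (h : i ≤ k) :
    (F.splice F' k).dataUpTo i = F.dataUpTo i := by
  refine Finset.sum_congr rfl fun j _ => ?_
  split_ifs with hj
  · exact if_pos (hj.trans (Fin.castSucc_le_castSucc_iff.mpr h))
  · rfl

theorem dataUpTo_splice_of_lt (F F' : SplitFaults R Q A Z X) {i k : Fin R} (h : k < i) :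
    (F.splice F' k).dataUpTo i = F.dataUpTo k + F'.dataUpTo k + F'.dataUpTo i := by
  simp only [dataUpTo, ← Finset.sum_add_distrib]
  refine Finset.sum_congr rfl fun j _ => ?_
  by_cases hj : j ≤ k.castSucc
  · have hi : j ≤ i.castSucc := hj.trans (Fin.castSucc_le_castSucc_iff.mpr h.le)
    simp [splice, hj, hi, add_assoc, Pauli.add_self]
  · simp [splice, hj]

/-- The record `rec` can be reported under the faults `F`: in every round the reported syndrome
is the syndrome of the accumulated error plus the flips. -/
def Consistent (C : CSSCode Z Q X) (L : Matrix Q A (ZMod 2)) (F : SplitFaults R Q A Z X)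
    (rec : SplitRecord R A Z X) : Prop :=
  ∀ k, rec.synX k + F.flipX k = C.HX *ᵥ (F.initial L rec.out + F.dataUpTo k).z ∧
    rec.synZ k + F.flipZ k = C.HZ *ᵥ (F.initial L rec.out + F.dataUpTo k).x

variable {C : CSSCode Z Q X} {L : Matrix Q A (ZMod 2)} {F F' : SplitFaults R Q A Z X}
  {rec : SplitRecord R A Z X}

/-- Two explanations of a record can be spliced at a round whose outcomes both of them regard as
correct, since their accumulated errors have the same syndrome there. -/
theorem Consistent.splice (h : F.Consistent C L rec) (h' : F'.Consistent C L rec) {k : Fin R}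
    (hX : F.flipX k = 0) (hZ : F.flipZ k = 0) (hX' : F'.flipX k = 0) (hZ' : F'.flipZ k = 0) :
    (F.splice F' k).Consistent C L rec := by
  intro i
  have hinit : (F.splice F' k).initial L rec.out = F.initial L rec.out := rfl
  rw [hinit]
  by_cases hi : i ≤ k
  · rw [dataUpTo_splice_of_le _ _ hi]
    simpa [SplitFaults.splice, hi] using h i
  · rw [dataUpTo_splice_of_lt _ _ (not_le.mp hi)]
    obtain ⟨a₁, a₂⟩ := h k
    obtain ⟨b₁, b₂⟩ := h' k
    obtain ⟨c₁, c₂⟩ := h' i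
    rw [hX, add_zero] at a₁
    rw [hZ, add_zero] at a₂
    rw [hX', add_zero] at b₁
    rw [hZ', add_zero] at b₂
    have e₁ := a₁.symm.trans b₁
    have e₂ := a₂.symm.trans b₂
    have hlX : (F.splice F' k).flipX i = F'.flipX i := if_neg hi
    have hlZ : (F.splice F' k).flipZ i = F'.flipZ i := if_neg hi
    rw [hlX, hlZ, c₁, c₂]
    simp only [Pauli.add_x, Pauli.add_z, mulVec_add] at e₁ e₂ ⊢
    rw [← add_assoc, ← add_assoc, e₁, ← add_assoc, ← add_assoc, e₂,
      add_assoc (C.HX *ᵥ _) _ (C.HX *ᵥ (F'.dataUpTo k).z), ZModModule.add_self, add_zero,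
      add_assoc (C.HZ *ᵥ _) _ (C.HZ *ᵥ (F'.dataUpTo k).x), ZModModule.add_self, add_zero]
    exact ⟨rfl, rfl⟩

/-- Two patterns of fewer than `R` faults in total have a round without flips in common. -/
theorem exists_flip_eq_zero (h : F.number + F'.number < R) :
    ∃ k, F.flipX k = 0 ∧ F.flipZ k = 0 ∧ F'.flipX k = 0 ∧ F'.flipZ k = 0 := by
  by_contra! hk
  refine h.not_ge ?_
  calc R = ∑ k : Fin R, 1 := by simp
    _ ≤ ∑ k, (hammingNorm (F.flipX k) + hammingNorm (F.flipZ k) +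
        (hammingNorm (F'.flipX k) + hammingNorm (F'.flipZ k))) := by
      refine Finset.sum_le_sum fun k _ => ?_
      by_contra! hlt
      have h0 : ∀ {a b c d : ℕ}, a + b + (c + d) < 1 → a = 0 ∧ b = 0 ∧ c = 0 ∧ d = 0 := by
        omega
      obtain ⟨h₁, h₂, h₃, h₄⟩ := h0 hlt
      rw [hammingNorm_eq_zero] at h₁ h₂ h₃ h₄
      exact hk k h₁ h₂ h₃ h₄
    _ ≤ F.number + F'.number := by
      rw [Finset.sum_add_distrib]
      exact Nat.add_le_add (Nat.le_add_left _ _) (Nat.le_add_left _ _)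

/-- Let `F'` have the fewest faults among the patterns consistent with the record that satisfy
the weight bound. Up to a round without flips, `F'` has no more faults than any competitor `F`:
otherwise following `F` up to that round and `F'` afterwards would improve on `F'`. -/
theorem numberUpTo_le_of_minimal {d : ℕ} (h : F.Consistent C L rec)
    (hd : 2 * (F.input.weight + F.number) < d) (h' : F'.Consistent C L rec)
    (hmin : ∀ G : SplitFaults R Q A Z X, G.Consistent C L rec →
      2 * (G.input.weight + G.number) < d → F'.number ≤ G.number) {k : Fin R}
    (hX : F.flipX k = 0) (hZ : F.flipZ k = 0) (hX' : F'.flipX k = 0) (hZ' : F'.flipZ k = 0) :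
    F'.numberUpTo k ≤ F.numberUpTo k := by
  by_contra! hlt
  have h₁ := hmin F h hd
  have h₂ := number_splice F F' k
  have h₃ := number_eq F' k
  have h₄ : (F.splice F' k).input = F.input := rfl
  have h₅ := hmin _ (h.splice h' hX hZ hX' hZ') (by rw [h₄]; omega)
  omega

theorem number_none (R : ℕ) (Q A Z X : Type*) [Fintype Q] [Fintype A] [Fintype Z] [Fintype X] :
    (SplitFaults.none R Q A Z X).number = 0 := by
  simp [number, none, Pauli.weight]

theorem weight_input_none (R : ℕ) (Q A Z X : Type*) [Fintype Q] [Fintype A] :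
    (SplitFaults.none R Q A Z X).input.weight = 0 := by
  simp [none, Pauli.weight]

/-- An explanation for every record: the absence of faults if it explains the
record, and otherwise a consistent fault pattern with the fewest faults during the procedure
among those that satisfy the weight bound, if there is one. -/
theorem exists_explanation (C : CSSCode Z Q X) (L : Matrix Q A (ZMod 2)) (d : ℕ)
    (rec : SplitRecord R A Z X) : ∃ F' : SplitFaults R Q A Z X,
      ((SplitFaults.none R Q A Z X).Consistent C L rec → F' = SplitFaults.none R Q A Z X) ∧
      ∀ F : SplitFaults R Q A Z X, F.Consistent C L rec →
        2 * (F.input.weight + F.number) < d →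
        F'.Consistent C L rec ∧ 2 * (F'.input.weight + F'.number) < d ∧
          F'.number ≤ F.number := by
  have hn₁ := number_none R Q A Z X
  have hn₂ := weight_input_none R Q A Z X
  by_cases h0 : (SplitFaults.none R Q A Z X).Consistent C L rec
  · refine ⟨_, fun _ => rfl, fun F _ hd => ⟨h0, ?_, ?_⟩⟩ <;> omega
  · by_cases h1 : {F : SplitFaults R Q A Z X | F.Consistent C L rec ∧
        2 * (F.input.weight + F.number) < d}.Nonempty
    · let F' := Function.argminOn (number : SplitFaults R Q A Z X → ℕ) _ h1
      have hF' := Function.argminOn_mem (number : SplitFaults R Q A Z X → ℕ) _ h1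
      refine ⟨F', fun h => absurd h h0, fun F hF hd => ⟨hF'.1, hF'.2, ?_⟩⟩
      exact Function.argminOn_le (number : SplitFaults R Q A Z X → ℕ) _
        (Set.mem_ofPred.mpr ⟨hF, hd⟩)
    · exact ⟨SplitFaults.none R Q A Z X, fun _ => rfl, fun F hF hd => absurd ⟨F, hF, hd⟩ h1⟩

end SplitFaults

/-! ### Fault tolerance of splitting -/

namespace CSSCode

variable {Z Q X A K N : Type*} [Fintype Z] [Fintype Q] [Fintype X] [DecidableEq X] [Fintype A]
  [DecidableEq A]

theorem IsCodeState.smul {C : CSSCode Z Q X} {χ : QState Q} (h : C.IsCodeState χ) (c : ℂ) :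
    C.IsCodeState (c • χ) where
  mulVec_eq_zero b hb := h.mulVec_eq_zero b (right_ne_zero_of_mul hb)
  add_mulVec b l := congrArg (c * ·) (h.add_mulVec b l)

/-- The split procedure in a given branch: the amplitude is zero unless the record is consistent
with the faults, and the output is the ideal output with the accumulated Pauli error and the
correction applied. -/
theorem exists_runSplit_eq_smul (C : CSSCode Z Q X) {R : ℕ} (dec : SplitRecord R A Z X → Pauli Q)
    (L : Matrix Q A (ZMod 2)) {encIn : QState K → QState (Q ⊕ A)} {out : QState K → QState Q}
    {c₀ : ℂ} (hout : ∀ φ, C.IsCodeState (out φ))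
    (hmeas : ∀ s φ, measureOutX s (encIn φ) = c₀ • Pauli.act ⟨0, L *ᵥ s⟩ (out φ))
    (F : SplitFaults R Q A Z X) (rec : SplitRecord R A Z X) :
    ∃ c : ℂ, (c ≠ 0 → F.Consistent C L rec) ∧ ∀ φ, C.runSplit dec F rec (encIn φ) =
      c • (dec rec + (F.initial L rec.out + ∑ j, F.data j)).act (out φ) := by
  obtain ⟨c, hc, h⟩ := exists_foldl_proj_eq_smul C R (fun k => F.data k.castSucc)
    (fun k => rec.synX k + F.flipX k) (fun k => rec.synZ k + F.flipZ k) (F.initial L rec.out)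
  let s := rec.out + F.flipOut + F.input.z ∘ Sum.inr
  let c₁ : ℂ := sgn (s ⬝ᵥ (F.input.x ∘ Sum.inr)) *
    (c₀ * sgn (L *ᵥ s ⬝ᵥ (F.input.x ∘ Sum.inl)))
  have hinit (φ) : measureOutX (rec.out + F.flipOut) (F.input.act (encIn φ)) =
      (F.initial L rec.out).act (c₁ • out φ) := by
    have hP : (⟨F.input.x ∘ Sum.inl, F.input.z ∘ Sum.inl⟩ : Pauli Q) + ⟨0, L *ᵥ s⟩ =
        F.initial L rec.out := Pauli.eq_of_parts (add_zero _) rfl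
    rw [measureOutX_act, hmeas, Pauli.act_smul, Pauli.act_act, hP, Pauli.act_smul, smul_smul,
      smul_smul, mul_assoc]
  let P := F.initial L rec.out + ∑ j : Fin R, F.data j.castSucc
  let c₂ : ℂ := sgn (P.z ⬝ᵥ (F.data (Fin.last R)).x) *
    sgn ((F.data (Fin.last R) + P).z ⬝ᵥ (dec rec).x)
  refine ⟨c * c₁ * c₂, fun hne k => ?_, fun φ => ?_⟩
  · have hk := hc (left_ne_zero_of_mul (left_ne_zero_of_mul hne)) k
    have hsum : (∑ j : Fin R, if j ≤ k then F.data j.castSucc else 0) = F.dataUpTo k := by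
      rw [SplitFaults.dataUpTo, Fin.sum_univ_castSucc]
      simp
    rwa [hsum] at hk
  · have htot : F.data (Fin.last R) + P = F.initial L rec.out + ∑ j, F.data j := by
      rw [Fin.sum_univ_castSucc, add_comm, add_assoc]
    rw [runSplit, hinit, h _ ((hout φ).smul c₁), ← htot]
    simp only [Pauli.act_smul, Pauli.act_act, smul_smul]
    congr 1
    simp only [c₂, P]
    ring

/-- Two explanations of the same record that have fewer than `d` faults in total have equivalent
accumulated errors at a round without flips. Hence undoing the initial error of `F'` leaves,
of the errors of `F`, only those after that round, at the cost of the errors of `F'` before. -/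
theorem exists_act_initial_add_eq_smul (C : CSSCode Z Q X) {R d : ℕ} {L : Matrix Q A (ZMod 2)}
    {out : QState K → QState Q}
    (htrivX : ∀ x, C.HZ *ᵥ x = 0 → hammingNorm x < d →
      ∀ φ, Pauli.act ⟨x, 0⟩ (out φ) = out φ)
    (htrivZ : ∀ z a, C.HX *ᵥ (z + L *ᵥ a) = 0 → hammingNorm z + hammingNorm a < d →
      ∀ φ, Pauli.act ⟨0, z + L *ᵥ a⟩ (out φ) = out φ)
    {F F' : SplitFaults R Q A Z X} {rec : SplitRecord R A Z X} (h : F.Consistent C L rec)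
    (h' : F'.Consistent C L rec)
    (hd : F.input.weight + F.number + (F'.input.weight + F'.number) < d) {k : Fin R}
    (hX : F.flipX k = 0) (hZ : F.flipZ k = 0) (hX' : F'.flipX k = 0) (hZ' : F'.flipZ k = 0) :
    ∃ c : ℂ, ∀ φ, (F'.initial L rec.out + (F.initial L rec.out + ∑ j, F.data j)).act (out φ) =
      c • (F'.dataUpTo k + F.dataAfter k).act (out φ) := by
  let E := F'.dataUpTo k + F.dataAfter k
  let G := F'.initial L rec.out + F'.dataUpTo k + (F.initial L rec.out + F.dataUpTo k)
  have hEG : F'.initial L rec.out + (F.initial L rec.out + ∑ j, F.data j) = E + G := by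
    have e : E + G = F'.initial L rec.out + (F.initial L rec.out +
        (F.dataUpTo k + F.dataAfter k)) + (F'.dataUpTo k + F'.dataUpTo k) := by
      simp only [E, G]
      abel
    rw [e, Pauli.add_self, add_zero, F.sum_data k]
  let D : Pauli Q := (⟨F.input.x ∘ Sum.inl, F.input.z ∘ Sum.inl⟩ + F.dataUpTo k) +
    (⟨F'.input.x ∘ Sum.inl, F'.input.z ∘ Sum.inl⟩ + F'.dataUpTo k)
  let a : A → ZMod 2 := (F.flipOut + F.input.z ∘ Sum.inr) + (F'.flipOut + F'.input.z ∘ Sum.inr)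
  have hGx : G.x = D.x := by
    change F'.input.x ∘ Sum.inl + (F'.dataUpTo k).x + (F.input.x ∘ Sum.inl + (F.dataUpTo k).x) =
      F.input.x ∘ Sum.inl + (F.dataUpTo k).x + (F'.input.x ∘ Sum.inl + (F'.dataUpTo k).x)
    abel
  have hGz : G.z = D.z + L *ᵥ a := by
    -- The reported outcomes occur twice and cancel.
    have e : G.z = D.z + L *ᵥ a + (L *ᵥ rec.out + L *ᵥ rec.out) := by
      simp only [G, D, a, SplitFaults.initial, Pauli.add_z, mulVec_add]
      abel
    rw [e, ZModModule.add_self, add_zero]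
  have hweight : D.weight + hammingNorm a < d := by
    have h₁ := F.weight_input_eq
    have h₂ := F'.weight_input_eq
    have h₃ := F.hammingNorm_flipOut_add_weight_dataUpTo_le k
    have h₄ := F'.hammingNorm_flipOut_add_weight_dataUpTo_le k
    have h₅ := F.number_eq k
    have h₆ := F'.number_eq k
    have h₇ := Pauli.hammingNorm_z_le
      (⟨F.input.x ∘ Sum.inr, F.input.z ∘ Sum.inr⟩ : Pauli A)
    have h₈ := Pauli.hammingNorm_z_le
      (⟨F'.input.x ∘ Sum.inr, F'.input.z ∘ Sum.inr⟩ : Pauli A)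
    have h₉ : D.weight ≤ _ := (Pauli.weight_add_le _ _).trans
      (Nat.add_le_add (Pauli.weight_add_le _ _) (Pauli.weight_add_le _ _))
    have h₁₀ : hammingNorm a ≤ _ := (hammingNorm_add_le _ _).trans
      (Nat.add_le_add (hammingNorm_add_le _ _) (hammingNorm_add_le _ _))
    dsimp only at h₇ h₈
    omega
  obtain ⟨a₁, a₂⟩ := h k
  obtain ⟨b₁, b₂⟩ := h' k
  rw [hX, add_zero] at a₁
  rw [hZ, add_zero] at a₂
  rw [hX', add_zero] at b₁
  rw [hZ', add_zero] at b₂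
  have hsX : C.HX *ᵥ G.z = 0 := by
    rw [Pauli.add_z, mulVec_add, ← a₁, ← b₁, ZModModule.add_self]
  have hsZ : C.HZ *ᵥ G.x = 0 := by
    rw [Pauli.add_x, mulVec_add, ← a₂, ← b₂, ZModModule.add_self]
  have hG (φ) : G.act (out φ) = out φ := by
    rw [Pauli.act_eq_act_act, htrivX G.x hsZ, hGz, htrivZ _ _ (hGz ▸ hsX)]
    · exact (Nat.add_le_add_right D.hammingNorm_z_le _).trans_lt hweight
    · rw [hGx]
      exact D.hammingNorm_x_le.trans_lt ((Nat.le_add_right _ _).trans_lt hweight)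
  refine ⟨sgn (G.z ⬝ᵥ E.x), fun φ => ?_⟩
  have hE := E.act_act G (out φ)
  rw [hG] at hE
  rw [hEG, hE, smul_smul, sgn_mul_self, one_smul]

/-- Fault tolerance of splitting, for an ideal output `encOut (S φ)` that is fixed by all
undetectable errors of weight less than `d`. Here an undetectable `Z`-error consists of
a `Z`-error `z` on `Q` and flips `a` of the outcomes of `A`. -/
theorem exists_splitImplements_and_splitFaultTolerant (C : CSSCode Z Q X) {R d : ℕ} (hR : d ≤ R)
    (L : Matrix Q A (ZMod 2)) {encIn : QState K → QState (Q ⊕ A)} {encOut : QState N → QState Q}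
    {S : QState K → QState N} {c₀ : ℂ} (hout : ∀ φ, C.IsCodeState (encOut (S φ)))
    (hmeas : ∀ s φ, measureOutX s (encIn φ) = c₀ • Pauli.act ⟨0, L *ᵥ s⟩ (encOut (S φ)))
    (htrivX : ∀ x, C.HZ *ᵥ x = 0 → hammingNorm x < d →
      ∀ φ, Pauli.act ⟨x, 0⟩ (encOut (S φ)) = encOut (S φ))
    (htrivZ : ∀ z a, C.HX *ᵥ (z + L *ᵥ a) = 0 → hammingNorm z + hammingNorm a < d →
      ∀ φ, Pauli.act ⟨0, z + L *ᵥ a⟩ (encOut (S φ)) = encOut (S φ)) :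
    ∃ dec : SplitRecord R A Z X → Pauli Q,
      C.SplitImplements dec encIn encOut S ∧ C.SplitFaultTolerant dec encIn encOut S d := by
  choose ex hnone hex using SplitFaults.exists_explanation (R := R) C L d
  -- The decoder undoes the error that the explanation has right after measuring out `A`, and
  -- leaves alone the later data errors of the explanation.
  refine ⟨fun rec => (ex rec).initial L rec.out, fun rec => ?_, fun F rec hF => ?_⟩
  · obtain ⟨c, hc, h⟩ := C.exists_runSplit_eq_smul (fun rec => (ex rec).initial L rec.out) L
      hout hmeas (SplitFaults.none R Q A Z X) rec
    refine ⟨c, fun φ => ?_⟩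
    rw [h]
    by_cases hc0 : c = 0
    · rw [hc0, zero_smul, zero_smul]
    · have hdata : ∑ j, (SplitFaults.none R Q A Z X).data j = 0 :=
        Finset.sum_eq_zero fun _ _ => rfl
      rw [hnone rec (hc hc0), hdata, add_zero, Pauli.add_self, Pauli.act_zero]
  · obtain ⟨c, hc, h⟩ := C.exists_runSplit_eq_smul (fun rec => (ex rec).initial L rec.out) L
      hout hmeas F rec
    by_cases hc0 : c = 0
    · refine ⟨0, 0, by simp, fun φ => ?_⟩
      rw [h, hc0, zero_smul, zero_smul]
    have hcons := hc hc0
    obtain ⟨hcons', hd, hle⟩ : (ex rec).Consistent C L rec ∧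
        F.input.weight + F.number + ((ex rec).input.weight + (ex rec).number) < d ∧
        ∀ k, F.flipX k = 0 → F.flipZ k = 0 → (ex rec).flipX k = 0 → (ex rec).flipZ k = 0 →
          (ex rec).numberUpTo k ≤ F.numberUpTo k := by
      rcases hF with hF | ⟨hF, φ, hφ⟩
      · obtain ⟨h₁, h₂, h₃⟩ := hex rec F hcons hF
        exact ⟨h₁, by omega, fun k => SplitFaults.numberUpTo_le_of_minimal hcons hF h₁
          fun G hG hGd => (hex rec G hG hGd).2.2⟩
      · obtain ⟨c', hc', h'⟩ := C.exists_runSplit_eq_smul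
          (fun rec => (ex rec).initial L rec.out) L hout hmeas (SplitFaults.none R Q A Z X) rec
        have hn : (SplitFaults.none R Q A Z X).Consistent C L rec := by
          refine hc' fun h0 => hφ ?_
          rw [h', h0, zero_smul]
        rw [hnone rec hn]
        have h₁ := SplitFaults.number_none R Q A Z X
        have h₂ := SplitFaults.weight_input_none R Q A Z X
        refine ⟨hn, by omega, fun k _ _ _ _ => ?_⟩
        have h₃ := (SplitFaults.none R Q A Z X).number_eq k
        omega
    obtain ⟨k, hX, hZ, hX', hZ'⟩ :=
      SplitFaults.exists_flip_eq_zero (F := F) (F' := ex rec) (R := R) (by omega)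
    obtain ⟨c', h'⟩ := C.exists_act_initial_add_eq_smul htrivX htrivZ hcons hcons' hd
      hX hZ hX' hZ'
    refine ⟨(ex rec).dataUpTo k + F.dataAfter k, c * c', ?_, fun φ => ?_⟩
    · have h₁ := Pauli.weight_add_le ((ex rec).dataUpTo k) (F.dataAfter k)
      have h₂ := (ex rec).hammingNorm_flipOut_add_weight_dataUpTo_le k
      have h₃ := F.weight_dataAfter_le k
      have h₄ := F.number_eq k
      have h₅ := hle k hX hZ hX' hZ'
      omega
    · rw [h, h', smul_smul]

end CSSCode

namespace CSSCode

variable {Z Q X N : Type*} [Fintype Z] [Fintype Q] [Fintype X]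

/-! ### Encoded states -/

theorem pairing_cls (C : CSSCode Z Q X) {y z : Q → ZMod 2} (hy : C.HZ *ᵥ y = 0)
    (hz : z ∈ C.cycles) : C.pairing y hy (C.cls z hz) = z ⬝ᵥ y := rfl

theorem cls_eq_zero_iff (C : CSSCode Z Q X) {z : Q → ZMod 2} (hz : z ∈ C.cycles) :
    C.cls z hz = 0 ↔ z ∈ C.boundaries :=
  Submodule.Quotient.mk_eq_zero _

theorem exists_cls_eq (C : CSSCode Z Q X) (x : C.H0) : ∃ z hz, C.cls z hz = x := by
  obtain ⟨⟨z, hz⟩, rfl⟩ := Submodule.Quotient.mk_surjective _ x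
  exact ⟨z, hz, rfl⟩

theorem isCodeState_encode (C : CSSCode Z Q X) (u : Module.Basis N (ZMod 2) C.H0)
    (ψ : QState N) : C.IsCodeState (C.encode u ψ) where
  mulVec_eq_zero b hb := by
    by_contra h
    exact hb (dif_neg h)
  add_mulVec b l := by
    have hl : C.HZ *ᵥ (C.HXᵀ *ᵥ l) = 0 := by
      rw [mulVec_mulVec, show C.HZ * C.HXᵀ = 0 from C.dual.comm, zero_mulVec]
    have hadd : C.HZ *ᵥ (b + C.HXᵀ *ᵥ l) = C.HZ *ᵥ b := by rw [mulVec_add, hl, add_zero]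
    by_cases hb : C.HZ *ᵥ b = 0
    · rw [encode, encode, dif_pos hb, dif_pos (hadd.trans hb)]
      congr 1
      funext k
      obtain ⟨z, hz, hk⟩ := C.exists_cls_eq (u k)
      have hz' : C.HX *ᵥ z = 0 := hz
      rw [← hk, pairing_cls, pairing_cls, dotProduct_add, dotProduct_mulVec, vecMul_transpose,
        hz', zero_dotProduct, add_zero]
    · rw [encode, encode, dif_neg hb, dif_neg fun h => hb (hadd.symm.trans h)]

theorem distZ_le (C : CSSCode Z Q X) {z : Q → ZMod 2} (hz : C.IsLogicalZ z) :
    C.distZ ≤ hammingNorm z :=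
  Nat.sInf_le ⟨z, hz, rfl⟩

theorem mem_boundaries_of_hammingNorm_lt (C : CSSCode Z Q X) {z : Q → ZMod 2}
    (hz : C.HX *ᵥ z = 0) (hd : hammingNorm z < C.distZ) : z ∈ C.boundaries := by
  by_contra h
  exact (C.distZ_le ⟨hz, h⟩).not_gt hd

theorem IsCodeState.act_x_eq_self {C : CSSCode Z Q X} {χ : QState Q} (hχ : C.IsCodeState χ)
    {x : Q → ZMod 2} (hx : x ∈ C.dual.boundaries) : Pauli.act ⟨x, 0⟩ χ = χ := by
  obtain ⟨l, rfl⟩ := hx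
  ext b
  simp only [Pauli.act, zero_dotProduct, sgn_zero, one_mul]
  exact hχ.add_mulVec b l

end CSSCode

/-! ### Homology of the sandwiched code -/

section Sandwich

variable {Z₁ Q₁ X₁ Z₂ Q₂ X₂ V₀ Vm I J : Type*}
    [Fintype Z₁] [Fintype Q₁] [Fintype X₁] [Fintype Z₂] [Fintype Q₂] [Fintype X₂]
    [Fintype V₀] [Fintype Vm]
    [DecidableEq Z₁] [DecidableEq Q₁] [DecidableEq X₁]
    [DecidableEq Z₂] [DecidableEq Q₂] [DecidableEq X₂]
    {C : CSSCode Z₁ Q₁ X₁} {D : CSSCode Z₂ Q₂ X₂} {V : CSSCode Empty V₀ Vm}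
    {f : CodeMap V C} {g : CodeMap V D} {u : Q₁ → ZMod 2} {v : Q₂ → ZMod 2}
    {bC : Module.Basis I (ZMod 2) C.H0} {bD : Module.Basis J (ZMod 2) D.H0} {i₀ : I} {j₀ : J}

theorem directSum_HX_mul_fromRows (f : CodeMap V C) (g : CodeMap V D) :
    (C.directSum D).HX * fromRows f.f₀ g.f₀ = fromRows f.fm g.fm * V.HX := by
  simp [CSSCode.directSum, Matrix.fromBlocks_mul_fromRows, Matrix.fromRows_mul, f.comm₀, g.comm₀]

theorem sandwich_HX_mulVec (f : CodeMap V C) (g : CodeMap V D) (z : Q₁ ⊕ Q₂ → ZMod 2)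
    (a : Vm → ZMod 2) : (sandwich V C D f g).HX *ᵥ Sum.elim z a =
      (C.directSum D).HX *ᵥ z + fromRows f.fm g.fm *ᵥ a := by
  simp only [sandwich, CSSCode.directSum, fromCols_mulVec, Sum.elim_comp_inl, Sum.elim_comp_inr]

theorem sandwich_HZ_mulVec (f : CodeMap V C) (g : CodeMap V D) (y : Q₁ ⊕ Q₂ → ZMod 2)
    (c : Vm → ZMod 2) : (sandwich V C D f g).HZ *ᵥ Sum.elim y c =
      Sum.elim ((C.directSum D).HZ *ᵥ y) ((fromRows f.f₀ g.f₀)ᵀ *ᵥ y + V.HXᵀ *ᵥ c) := by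
  simp only [sandwich, CSSCode.directSum, fromBlocks_mulVec, Sum.elim_comp_inl,
    Sum.elim_comp_inr, transpose_fromRows, zero_mulVec, add_zero]

theorem sandwich_HZ_transpose_mulVec (f : CodeMap V C) (g : CodeMap V D) (l : Z₁ ⊕ Z₂ → ZMod 2)
    (τ : V₀ → ZMod 2) : (sandwich V C D f g).HZᵀ *ᵥ Sum.elim l τ =
      Sum.elim ((C.directSum D).HZᵀ *ᵥ l + fromRows f.f₀ g.f₀ *ᵥ τ) (V.HX *ᵥ τ) := by
  have h : (sandwich V C D f g).HZᵀ =
      fromBlocks (C.directSum D).HZᵀ (fromRows f.f₀ g.f₀) 0 V.HX := by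
    simp [sandwich, CSSCode.directSum, fromBlocks_transpose, transpose_fromCols]
  rw [h, fromBlocks_mulVec]
  simp

theorem mem_sandwich_boundaries_iff {z : Q₁ ⊕ Q₂ → ZMod 2} {a : Vm → ZMod 2} :
    Sum.elim z a ∈ (sandwich V C D f g).boundaries ↔
      ∃ l τ, (C.directSum D).HZᵀ *ᵥ l + fromRows f.f₀ g.f₀ *ᵥ τ = z ∧ V.HX *ᵥ τ = a := by
  constructor
  · rintro ⟨m, hm⟩
    rw [← Sum.elim_comp_inl_inr m, mulVecLin_apply, sandwich_HZ_transpose_mulVec,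
      Sum.elim_eq_iff] at hm
    exact ⟨_, _, hm⟩
  · rintro ⟨l, τ, rfl, rfl⟩
    exact ⟨Sum.elim l τ, sandwich_HZ_transpose_mulVec f g l τ⟩

theorem fromRows_mulVec_mem_cycles (f : CodeMap V C) (g : CodeMap V D) {κ : V₀ → ZMod 2}
    (hκ : V.HX *ᵥ κ = 0) : fromRows f.f₀ g.f₀ *ᵥ κ ∈ (C.directSum D).cycles := by
  change (C.directSum D).HX *ᵥ _ = 0
  rw [mulVec_mulVec, directSum_HX_mul_fromRows, ← mulVec_mulVec, hκ, mulVec_zero]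

theorem IsLogicalOperatorSubcomplex.mulVec_apply_eq_zero
    (hu : IsLogicalOperatorSubcomplex V C f u) (κ : V₀ → ZMod 2) {q : Q₁} (hq : u q = 0) :
    (f.f₀ *ᵥ κ) q = 0 := by
  obtain ⟨e, -, h₀, h⟩ := hu.basis
  refine Finset.sum_eq_zero fun i _ => ?_
  have hne : q ≠ e i := fun hqi => (h q).mp ⟨i, hqi.symm⟩ hq
  change f.f₀ q i * κ i = 0
  rw [h₀ q i hne, zero_mul]

theorem IsLogicalOperatorSubcomplex.mulVec_one (hu : IsLogicalOperatorSubcomplex V C f u) :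
    f.f₀ *ᵥ 1 = u := by
  obtain ⟨e, h₁, h₀, h⟩ := hu.basis
  ext q
  by_cases hq : u q = 0
  · rw [hu.mulVec_apply_eq_zero _ hq, hq]
  · obtain ⟨i, rfl⟩ := (h q).mpr hq
    have hu1 : u (e i) = 1 := (by decide : ∀ a : ZMod 2, a ≠ 0 → a = 1) _ hq
    rw [hu1, mulVec, dotProduct, Finset.sum_eq_single i, h₁, Pi.one_apply, mul_one]
    · intro j _ hj
      rw [h₀ _ _ (e.injective.ne hj.symm), zero_mul]
    · simp

theorem IsLogicalOperatorSubcomplex.HX_mulVec_one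
    (hu : IsLogicalOperatorSubcomplex V C f u) : V.HX *ᵥ 1 = 0 := by
  refine hu.inj ?_
  have h : C.HX *ᵥ u = 0 := hu.logical.1
  rw [mulVec_mulVec, f.comm₀, ← mulVec_mulVec, hu.mulVec_one, h, mulVec_zero]

theorem sumBasis_inl (i : I) : C.sumBasis D bC bD (Sum.inl i) =
    (CodeMap.inl C D).mapH0 (bC i) := by
  simp [CSSCode.sumBasis, CSSCode.directSumH0]

theorem sumBasis_inr (j : J) : C.sumBasis D bC bD (Sum.inr j) =
    (CodeMap.inr C D).mapH0 (bD j) := by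
  simp [CSSCode.sumBasis, CSSCode.directSumH0]

theorem cls_fromRows_mulVec_eq {κ : V₀ → ZMod 2} (hκ : V.HX *ᵥ κ = 0) :
    (C.directSum D).cls _ (fromRows_mulVec_mem_cycles f g hκ) =
      (CodeMap.inl C D).mapH0 (C.cls _ (f.map_cycles κ hκ)) +
        (CodeMap.inr C D).mapH0 (D.cls _ (g.map_cycles κ hκ)) := by
  rw [CodeMap.mapH0_cls, CodeMap.mapH0_cls, CSSCode.cls_add]
  refine CSSCode.cls_congr _ ?_ _ _
  ext (q | q) <;> simp [CodeMap.inl, CodeMap.inr, Matrix.fromRows_mulVec]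

/-- By separation, a cycle of `V` is trivial in both codes, or represents the two logical
operators that are merged. -/
theorem IsSeparated.cls_fromRows_mulVec (hsep : IsSeparated V C D f g u v bC bD i₀ j₀)
    (hu : IsLogicalOperatorSubcomplex V C f u) (hv : IsLogicalOperatorSubcomplex V D g v)
    {κ : V₀ → ZMod 2} (hκ : V.HX *ᵥ κ = 0) :
    (C.directSum D).cls _ (fromRows_mulVec_mem_cycles f g hκ) = 0 ∨
      (C.directSum D).cls _ (fromRows_mulVec_mem_cycles f g hκ) =
        C.sumBasis D bC bD (Sum.inl i₀) + C.sumBasis D bC bD (Sum.inr j₀) := by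
  rw [cls_fromRows_mulVec_eq hκ]
  have hiff := hsep.iff_logical κ
  by_cases h : f.f₀ *ᵥ κ ∈ C.boundaries
  · left
    have h' : g.f₀ *ᵥ κ ∈ D.boundaries := by
      by_contra h'
      exact (hiff.mpr ⟨g.map_cycles κ hκ, h'⟩).2 h
    rw [(C.cls_eq_zero_iff _).mpr h, (D.cls_eq_zero_iff _).mpr h', map_zero, map_zero, add_zero]
  · right
    have h' := (hiff.mp ⟨f.map_cycles κ hκ, h⟩).2
    rw [hsep.only_u _ _ h fun q hq hq' => hq (hu.mulVec_apply_eq_zero κ hq'),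
      hsep.only_v _ _ h' fun q hq hq' => hq (hv.mulVec_apply_eq_zero κ hq'), sumBasis_inl,
      sumBasis_inr]

theorem IsSeparated.cls_fromRows_mulVec_one (hsep : IsSeparated V C D f g u v bC bD i₀ j₀)
    (hu : IsLogicalOperatorSubcomplex V C f u) (hv : IsLogicalOperatorSubcomplex V D g v) :
    (C.directSum D).cls _ (fromRows_mulVec_mem_cycles f g hu.HX_mulVec_one) =
        C.sumBasis D bC bD (Sum.inl i₀) + C.sumBasis D bC bD (Sum.inr j₀) := by
  obtain ⟨h₁, h₂⟩ := hsep.class_u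
  obtain ⟨h₃, h₄⟩ := hsep.class_v
  rw [cls_fromRows_mulVec_eq hu.HX_mulVec_one, sumBasis_inl, sumBasis_inr, ← h₂, ← h₄,
    C.cls_congr hu.mulVec_one _ h₁, D.cls_congr hv.mulVec_one _ h₃]

theorem sandwichMap_mulVec (z : Q₁ ⊕ Q₂ → ZMod 2) :
    (sandwichMap V C D f g).f₀ *ᵥ z = Sum.elim z 0 := by
  simp [sandwichMap, fromRows_mulVec]

theorem mapH0_sandwichMap_cls_eq_zero_iff {z : Q₁ ⊕ Q₂ → ZMod 2}
    (hz : z ∈ (C.directSum D).cycles) :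
    (sandwichMap V C D f g).mapH0 ((C.directSum D).cls z hz) = 0 ↔
      ∃ κ, ∃ hκ : V.HX *ᵥ κ = 0, (C.directSum D).cls z hz =
        (C.directSum D).cls _ (fromRows_mulVec_mem_cycles f g hκ) := by
  rw [CodeMap.mapH0_cls, CSSCode.cls_eq_zero_iff, sandwichMap_mulVec,
    mem_sandwich_boundaries_iff]
  have hcls (κ : V₀ → ZMod 2) (hκ : V.HX *ᵥ κ = 0) :
      (C.directSum D).cls z hz = (C.directSum D).cls _ (fromRows_mulVec_mem_cycles f g hκ) ↔
        ∃ l, (C.directSum D).HZᵀ *ᵥ l + fromRows f.f₀ g.f₀ *ᵥ κ = z := by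
    rw [CSSCode.cls, CSSCode.cls, Submodule.Quotient.eq]
    exact exists_congr fun l => eq_sub_iff_add_eq
  constructor
  · rintro ⟨l, κ, h, hκ⟩
    exact ⟨κ, hκ, (hcls κ hκ).mpr ⟨l, h⟩⟩
  · rintro ⟨κ, hκ, h⟩
    obtain ⟨l, h⟩ := (hcls κ hκ).mp h
    exact ⟨l, κ, h, hκ⟩

/-- Every cycle of the sandwiched code can be pushed off the intermediate qubits, since the
differential of `V` is onto. -/
theorem mapH0_sandwichMap_surjective (hV : Function.Surjective V.HX.mulVec) :
    Function.Surjective (sandwichMap V C D f g).mapH0 := by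
  intro x
  obtain ⟨z, hz, rfl⟩ := (sandwich V C D f g).exists_cls_eq x
  obtain ⟨τ, hτ⟩ := hV (z ∘ Sum.inr)
  have hz' : (sandwich V C D f g).HX *ᵥ z = 0 := hz
  rw [← Sum.elim_comp_inl_inr z, sandwich_HX_mulVec, ← hτ, mulVec_mulVec,
    ← directSum_HX_mul_fromRows, ← mulVec_mulVec, ← mulVec_add] at hz'
  have hmem : z ∘ Sum.inl + fromRows f.f₀ g.f₀ *ᵥ τ ∈ (C.directSum D).cycles := hz'
  refine ⟨(C.directSum D).cls _ hmem, ?_⟩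
  rw [CodeMap.mapH0_cls, CSSCode.cls, CSSCode.cls, Submodule.Quotient.eq]
  refine ⟨Sum.elim 0 τ, ?_⟩
  change (sandwich V C D f g).HZᵀ *ᵥ Sum.elim 0 τ = (sandwichMap V C D f g).f₀ *ᵥ _ - z
  rw [sandwich_HZ_transpose_mulVec, sandwichMap_mulVec, hτ, mulVec_zero, zero_add]
  ext (q | q)
  · simp
  · simp

end Sandwich

section Sandwich

variable {Z₁ Q₁ X₁ Z₂ Q₂ X₂ V₀ Vm I J : Type*}
    [Fintype Z₁] [Fintype Q₁] [Fintype X₁] [Fintype Z₂] [Fintype Q₂] [Fintype X₂]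
    [Fintype V₀] [Fintype Vm] [Fintype I] [Fintype J]
    [DecidableEq Z₁] [DecidableEq Q₁] [DecidableEq X₁]
    [DecidableEq Z₂] [DecidableEq Q₂] [DecidableEq X₂] [DecidableEq I] [DecidableEq J]
    {C : CSSCode Z₁ Q₁ X₁} {D : CSSCode Z₂ Q₂ X₂} {V : CSSCode Empty V₀ Vm}
    {f : CodeMap V C} {g : CodeMap V D} {u : Q₁ → ZMod 2} {v : Q₂ → ZMod 2}
    {bC : Module.Basis I (ZMod 2) C.H0} {bD : Module.Basis J (ZMod 2) D.H0} {i₀ : I} {j₀ : J}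

theorem IsSeparated.mapH0_inl_eq_inr (hsep : IsSeparated V C D f g u v bC bD i₀ j₀)
    (hu : IsLogicalOperatorSubcomplex V C f u) (hv : IsLogicalOperatorSubcomplex V D g v) :
    (sandwichMap V C D f g).mapH0 (C.sumBasis D bC bD (Sum.inr j₀)) =
      (sandwichMap V C D f g).mapH0 (C.sumBasis D bC bD (Sum.inl i₀)) := by
  have h := (mapH0_sandwichMap_cls_eq_zero_iff (f := f) (g := g)
    (fromRows_mulVec_mem_cycles f g hu.HX_mulVec_one)).mpr ⟨1, hu.HX_mulVec_one, rfl⟩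
  rw [hsep.cls_fromRows_mulVec_one hu hv, map_add] at h
  rw [← sub_eq_zero, ← h, ZModModule.sub_eq_add, add_comm]

theorem IsSeparated.eq_zero_or_of_mapH0_eq_zero
    (hsep : IsSeparated V C D f g u v bC bD i₀ j₀)
    (hu : IsLogicalOperatorSubcomplex V C f u) (hv : IsLogicalOperatorSubcomplex V D g v)
    {x : (C.directSum D).H0} (hx : (sandwichMap V C D f g).mapH0 x = 0) :
    x = 0 ∨ x = C.sumBasis D bC bD (Sum.inl i₀) + C.sumBasis D bC bD (Sum.inr j₀) := by
  obtain ⟨z, hz, rfl⟩ := (C.directSum D).exists_cls_eq x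
  obtain ⟨κ, hκ, h⟩ := (mapH0_sandwichMap_cls_eq_zero_iff hz).mp hx
  rw [h]
  exact hsep.cls_fromRows_mulVec hu hv hκ

/-- The kernel of `H₀(ι)` is spanned by `[u] + [v]`, so that omitting `[v]` from the basis of
`H₀(C ⊕ D)` leaves vectors with linearly independent images, which still span. -/
theorem IsSeparated.exists_basis (hsep : IsSeparated V C D f g u v bC bD i₀ j₀)
    (hu : IsLogicalOperatorSubcomplex V C f u) (hv : IsLogicalOperatorSubcomplex V D g v) :
    ∃ w : Module.Basis {k : I ⊕ J // k ≠ Sum.inr j₀} (ZMod 2) (sandwich V C D f g).H0,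
      ∀ k, (sandwichMap V C D f g).mapH0 (C.sumBasis D bC bD k) = w (mergeIndex i₀ j₀ k) := by
  let b := C.sumBasis D bC bD
  let φ := (sandwichMap V C D f g).mapH0
  let w : {k : I ⊕ J // k ≠ Sum.inr j₀} → (sandwich V C D f g).H0 := fun k => φ (b k.1)
  have hw (k) : φ (b k) = w (mergeIndex i₀ j₀ k) := by
    unfold mergeIndex
    split_ifs with hk
    · rw [hk]
      exact hsep.mapH0_inl_eq_inr hu hv
    · rfl
  have hli : LinearIndependent (ZMod 2) w := by
    have hb : LinearIndependent (ZMod 2) fun k : {k : I ⊕ J // k ≠ Sum.inr j₀} => b k.1 :=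
      b.linearIndependent.comp _ Subtype.val_injective
    rw [Fintype.linearIndependent_iff] at hb ⊢
    intro a ha
    refine hb a ?_
    have h0 : φ (∑ k, a k • b k.1) = 0 := by
      rw [map_sum, ← ha]
      exact Finset.sum_congr rfl fun k _ => map_smul _ _ _
    refine (hsep.eq_zero_or_of_mapH0_eq_zero hu hv h0).resolve_right fun h => ?_
    -- The two sides differ in the coordinate `inr j₀`.
    have hc := congrArg (b.coord (Sum.inr j₀)) h
    rw [map_sum, map_add, Finset.sum_eq_zero] at hc
    · simp [b] at hc
    · intro k _
      rw [map_smul, b.coord_apply, b.repr_self, Finsupp.single_eq_of_ne k.2.symm, smul_zero]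
  have hspan : ⊤ ≤ Submodule.span (ZMod 2) (Set.range w) := by
    rw [← LinearMap.range_eq_top.mpr (mapH0_sandwichMap_surjective (f := f) (g := g) hu.onto),
      ← Submodule.map_top, ← b.span_eq, Submodule.map_span, Submodule.span_le]
    rintro _ ⟨_, ⟨k, rfl⟩, rfl⟩
    exact Submodule.subset_span ⟨_, (hw k).symm⟩
  exact ⟨Module.Basis.mk hli hspan, fun k => by rw [Module.Basis.mk_apply]; exact hw k⟩

theorem comp_mergeIndex_eq_iff {a : I ⊕ J → ZMod 2}
    {e : {k : I ⊕ J // k ≠ Sum.inr j₀} → ZMod 2} :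
    e ∘ mergeIndex i₀ j₀ = a ↔ a (Sum.inl i₀) = a (Sum.inr j₀) ∧ e = fun k => a k.1 := by
  constructor
  · rintro rfl
    refine ⟨by simp [mergeIndex], funext fun k => ?_⟩
    rw [Function.comp_apply, mergeIndex, dif_neg k.2]
  · rintro ⟨h, rfl⟩
    funext k
    simp only [Function.comp_apply, mergeIndex]
    split_ifs with hk
    · rw [hk, h]
    · rfl

theorem interpX_toMatrix_eq_splitMap {H H' : Type*} [AddCommGroup H] [Module (ZMod 2) H]
    [AddCommGroup H'] [Module (ZMod 2) H'] (b : Module.Basis (I ⊕ J) (ZMod 2) H)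
    (w : Module.Basis {k : I ⊕ J // k ≠ Sum.inr j₀} (ZMod 2) H') (φ : H →ₗ[ZMod 2] H')
    (h : ∀ k, φ (b k) = w (mergeIndex i₀ j₀ k)) :
    interpX (LinearMap.toMatrix b w φ) = splitMap i₀ j₀ := by
  funext ψ a
  have hF (e : {k : I ⊕ J // k ≠ Sum.inr j₀} → ZMod 2) :
      (LinearMap.toMatrix b w φ)ᵀ *ᵥ e = e ∘ mergeIndex i₀ j₀ := by
    funext k
    simp [mulVec, dotProduct, LinearMap.toMatrix_apply, h, Finsupp.single_apply]
  simp only [interpX, splitMap, hF, comp_mergeIndex_eq_iff]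
  split_ifs with ha <;> simp [ha]

/-! ### Encoded states of the sandwiched code -/

theorem pairing_sandwich {y : Q₁ ⊕ Q₂ → ZMod 2} {c : Vm → ZMod 2}
    (h : (sandwich V C D f g).HZ *ᵥ Sum.elim y c = 0) (hy : (C.directSum D).HZ *ᵥ y = 0)
    (x : (C.directSum D).H0) :
    (sandwich V C D f g).pairing _ h ((sandwichMap V C D f g).mapH0 x) =
      (C.directSum D).pairing y hy x := by
  obtain ⟨z, hz, rfl⟩ := (C.directSum D).exists_cls_eq x
  rw [CodeMap.mapH0_cls, CSSCode.pairing_cls, CSSCode.pairing_cls, sandwichMap_mulVec]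
  simp [dotProduct, Fintype.sum_sum_type]

/-- On an undetectable `X`-operator `y`, the two merged logical qubits differ by the pairing
with `u + v`. -/
theorem IsSeparated.dotProduct_one (hsep : IsSeparated V C D f g u v bC bD i₀ j₀)
    (hu : IsLogicalOperatorSubcomplex V C f u) (hv : IsLogicalOperatorSubcomplex V D g v)
    {y : Q₁ ⊕ Q₂ → ZMod 2} (hy : (C.directSum D).HZ *ᵥ y = 0) :
    fromRows f.f₀ g.f₀ *ᵥ 1 ⬝ᵥ y =
      (C.directSum D).pairing y hy (C.sumBasis D bC bD (Sum.inl i₀)) +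
        (C.directSum D).pairing y hy (C.sumBasis D bC bD (Sum.inr j₀)) := by
  rw [← (C.directSum D).pairing_cls hy (fromRows_mulVec_mem_cycles f g hu.HX_mulVec_one),
    hsep.cls_fromRows_mulVec_one hu hv, map_add]

theorem IsSeparated.dotProduct_eq_zero (hsep : IsSeparated V C D f g u v bC bD i₀ j₀)
    (hu : IsLogicalOperatorSubcomplex V C f u) (hv : IsLogicalOperatorSubcomplex V D g v)
    {y : Q₁ ⊕ Q₂ → ZMod 2} (hy : (C.directSum D).HZ *ᵥ y = 0)
    (heq : (C.directSum D).pairing y hy (C.sumBasis D bC bD (Sum.inl i₀)) =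
      (C.directSum D).pairing y hy (C.sumBasis D bC bD (Sum.inr j₀)))
    {κ : V₀ → ZMod 2} (hκ : V.HX *ᵥ κ = 0) : fromRows f.f₀ g.f₀ *ᵥ κ ⬝ᵥ y = 0 := by
  rw [← (C.directSum D).pairing_cls hy (fromRows_mulVec_mem_cycles f g hκ)]
  obtain h | h := hsep.cls_fromRows_mulVec hu hv hκ
  · rw [h, map_zero]
  · rw [h, map_add, heq, CharTwo.add_self_eq_zero]

/-- `Z`-operators in `V₀` that are cycles, like the `Z`-type generators, fix the encoded states
in the image of the split. -/
theorem IsSeparated.act_z_encode_splitMap (hsep : IsSeparated V C D f g u v bC bD i₀ j₀)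
    (hu : IsLogicalOperatorSubcomplex V C f u) (hv : IsLogicalOperatorSubcomplex V D g v)
    (l : Z₁ ⊕ Z₂ → ZMod 2) {κ : V₀ → ZMod 2} (hκ : V.HX *ᵥ κ = 0)
    (φ : QState {k : I ⊕ J // k ≠ Sum.inr j₀}) :
    Pauli.act ⟨0, (C.directSum D).HZᵀ *ᵥ l + fromRows f.f₀ g.f₀ *ᵥ κ⟩
      ((C.directSum D).encode (C.sumBasis D bC bD) (splitMap i₀ j₀ φ)) =
        (C.directSum D).encode (C.sumBasis D bC bD) (splitMap i₀ j₀ φ) := by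
  ext y
  simp only [Pauli.act, add_zero, CSSCode.encode, splitMap]
  split_ifs with hy heq
  · have hl : (C.directSum D).HZᵀ *ᵥ l ⬝ᵥ y = 0 := by
      rw [mulVec_transpose, ← dotProduct_mulVec, hy, dotProduct_zero]
    rw [add_dotProduct, hl, hsep.dotProduct_eq_zero hu hv hy heq hκ, add_zero, sgn_zero, one_mul]
  · exact mul_zero _
  · exact mul_zero _

/-- Measuring out the intermediate qubits of an encoded state with outcomes `s` gives the split
state, with the `Z`-operator `f₀ t + g₀ t` applied, for a preimage `t = S s` of `s` in `V₀`:
on the support of the state, the intermediate qubits are determined by the others. -/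
theorem IsSeparated.measureOutX_encode [DecidableEq Vm]
    (hsep : IsSeparated V C D f g u v bC bD i₀ j₀)
    (hu : IsLogicalOperatorSubcomplex V C f u) (hv : IsLogicalOperatorSubcomplex V D g v)
    {w : Module.Basis {k : I ⊕ J // k ≠ Sum.inr j₀} (ZMod 2) (sandwich V C D f g).H0}
    (hw : ∀ k, (sandwichMap V C D f g).mapH0 (C.sumBasis D bC bD k) = w (mergeIndex i₀ j₀ k))
    {S : Matrix V₀ Vm (ZMod 2)} (hS : V.HX * S = 1) (s : Vm → ZMod 2)
    (φ : QState {k : I ⊕ J // k ≠ Sum.inr j₀}) :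
    measureOutX s ((sandwich V C D f g).encode w φ) =
      (((Real.sqrt 2 : ℝ) : ℂ)⁻¹ ^ Fintype.card Vm) •
        Pauli.act ⟨0, (fromRows f.f₀ g.f₀ * S) *ᵥ s⟩
          ((C.directSum D).encode (C.sumBasis D bC bD) (splitMap i₀ j₀ φ)) := by
  have hw' (k) : w k = (sandwichMap V C D f g).mapH0 (C.sumBasis D bC bD k.1) := by
    rw [hw, mergeIndex, dif_neg k.2]
  ext y
  simp only [measureOutX, Pi.smul_apply, smul_eq_mul, Pauli.act, add_zero]
  congr 1
  have hT (c : Vm → ZMod 2) : (sandwich V C D f g).HZ *ᵥ Sum.elim y c = 0 ↔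
      (C.directSum D).HZ *ᵥ y = 0 ∧ V.HXᵀ *ᵥ c = (fromRows f.f₀ g.f₀)ᵀ *ᵥ y := by
    rw [sandwich_HZ_mulVec, ← Sum.elim_zero_zero, Sum.elim_eq_iff, ← ZModModule.sub_eq_add,
      sub_eq_zero, eq_comm (a := V.HXᵀ *ᵥ c)]
  by_cases hy : (C.directSum D).HZ *ᵥ y = 0
  swap
  · rw [CSSCode.encode, dif_neg hy, mul_zero]
    refine Finset.sum_eq_zero fun c _ => ?_
    rw [CSSCode.encode, dif_neg fun h => hy ((hT c).mp h).1, mul_zero]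
  have hflip (κ : V₀ → ZMod 2) : fromRows f.f₀ g.f₀ *ᵥ κ ⬝ᵥ y =
      κ ⬝ᵥ (fromRows f.f₀ g.f₀)ᵀ *ᵥ y := by
    rw [mulVec_transpose, dotProduct_comm, dotProduct_mulVec, dotProduct_comm]
  have hflip' (κ : V₀ → ZMod 2) (c : Vm → ZMod 2) : κ ⬝ᵥ V.HXᵀ *ᵥ c = V.HX *ᵥ κ ⬝ᵥ c := by
    rw [dotProduct_mulVec, vecMul_transpose]
  rw [CSSCode.encode, dif_pos hy, splitMap]
  split_ifs with heq
  · let c₀ : Vm → ZMod 2 := Sᵀ *ᵥ (fromRows f.f₀ g.f₀)ᵀ *ᵥ y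
    have hc₀ : V.HXᵀ *ᵥ c₀ = (fromRows f.f₀ g.f₀)ᵀ *ᵥ y := by
      -- Both sides agree on every `κ`, as `κ + S (∂ κ)` is a cycle of `V`.
      refine dotProduct_eq _ _ fun κ => ?_
      have hκ : V.HX *ᵥ (κ + S *ᵥ V.HX *ᵥ κ) = 0 := by
        rw [mulVec_add, mulVec_mulVec _ V.HX S, hS, one_mulVec, ZModModule.add_self]
      have h := hsep.dotProduct_eq_zero hu hv hy heq hκ
      rw [hflip, add_dotProduct, CharTwo.add_eq_zero] at h
      rw [dotProduct_comm, hflip', dotProduct_comm _ κ, h, dotProduct_mulVec, vecMul_transpose]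
    have huniq (c : Vm → ZMod 2) (hc : V.HXᵀ *ᵥ c = (fromRows f.f₀ g.f₀)ᵀ *ᵥ y) : c = c₀ := by
      simp only [c₀]
      rw [← hc, mulVec_mulVec, ← transpose_mul, hS, transpose_one, one_mulVec]
    rw [Finset.sum_eq_single c₀]
    · have h := (hT c₀).mpr ⟨hy, hc₀⟩
      rw [CSSCode.encode, dif_pos h]
      simp only [hw', pairing_sandwich h hy]
      rw [← mulVec_mulVec, hflip, dotProduct_mulVec s, vecMul_transpose]
    · intro c _ hc
      rw [CSSCode.encode, dif_neg fun h => hc (huniq c ((hT c).mp h).2), mul_zero]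
    · simp
  · rw [mul_zero]
    refine Finset.sum_eq_zero fun c _ => ?_
    rw [CSSCode.encode, dif_neg, mul_zero]
    intro h
    refine heq (CharTwo.add_eq_zero.mp ?_)
    rw [← hsep.dotProduct_one hu hv hy, hflip, ← ((hT c).mp h).2, hflip', hu.HX_mulVec_one,
      zero_dotProduct]

/-- An undetectable combination of a `Z`-error `z` and flips `a` of the outcomes of the
intermediate qubits is a cycle of the sandwiched code. If its weight is less than `d^Z` of
that code, it is a boundary, so that it acts trivially on the split states. -/
theorem IsSeparated.act_z_eq_self (hsep : IsSeparated V C D f g u v bC bD i₀ j₀)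
    (hu : IsLogicalOperatorSubcomplex V C f u) (hv : IsLogicalOperatorSubcomplex V D g v)
    [DecidableEq Vm] {S : Matrix V₀ Vm (ZMod 2)} (hS : V.HX * S = 1)
    {z : Q₁ ⊕ Q₂ → ZMod 2} {a : Vm → ZMod 2}
    (h : (C.directSum D).HX *ᵥ (z + (fromRows f.f₀ g.f₀ * S) *ᵥ a) = 0)
    (hd : hammingNorm z + hammingNorm a < (sandwich V C D f g).distZ)
    (φ : QState {k : I ⊕ J // k ≠ Sum.inr j₀}) :
    Pauli.act ⟨0, z + (fromRows f.f₀ g.f₀ * S) *ᵥ a⟩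
      ((C.directSum D).encode (C.sumBasis D bC bD) (splitMap i₀ j₀ φ)) =
        (C.directSum D).encode (C.sumBasis D bC bD) (splitMap i₀ j₀ φ) := by
  have hcyc : (sandwich V C D f g).HX *ᵥ Sum.elim z a = 0 := by
    rw [mulVec_add, mulVec_mulVec, ← Matrix.mul_assoc, directSum_HX_mul_fromRows,
      Matrix.mul_assoc, hS, Matrix.mul_one] at h
    rw [sandwich_HX_mulVec, h]
  rw [← hammingNorm_sum_elim] at hd
  obtain ⟨l, τ, rfl, rfl⟩ := mem_sandwich_boundaries_iff.mp
    (CSSCode.mem_boundaries_of_hammingNorm_lt _ hcyc hd)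
  have hκ : V.HX *ᵥ (τ + S *ᵥ V.HX *ᵥ τ) = 0 := by
    rw [mulVec_add, mulVec_mulVec _ V.HX S, hS, one_mulVec, ZModModule.add_self]
  rw [add_assoc, ← mulVec_mulVec _ _ S, ← mulVec_add]
  exact hsep.act_z_encode_splitMap hu hv l hκ φ

end Sandwich

theorem mainTheorem10 {Z₁ Q₁ X₁ Z₂ Q₂ X₂ V₀ Vm I J : Type*}
    [Fintype Z₁] [Fintype Q₁] [Fintype X₁] [Fintype Z₂] [Fintype Q₂] [Fintype X₂]
    [Fintype V₀] [Fintype Vm] [Fintype I] [Fintype J]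
    [DecidableEq Z₁] [DecidableEq Q₁] [DecidableEq X₁]
    [DecidableEq Z₂] [DecidableEq Q₂] [DecidableEq X₂]
    [DecidableEq Vm] [DecidableEq I] [DecidableEq J]
    (C : CSSCode Z₁ Q₁ X₁) (D : CSSCode Z₂ Q₂ X₂)
    (bC : Module.Basis I (ZMod 2) C.H0) (bD : Module.Basis J (ZMod 2) D.H0)
    (V : CSSCode Empty V₀ Vm) (f : CodeMap V C) (g : CodeMap V D)
    (u : Q₁ → ZMod 2) (v : Q₂ → ZMod 2)
    (hu : IsLogicalOperatorSubcomplex V C f u)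
    (hv : IsLogicalOperatorSubcomplex V D g v)
    (i₀ : I) (j₀ : J) (hsep : IsSeparated V C D f g u v bC bD i₀ j₀) :
    let T := sandwich V C D f g
    let b := C.sumBasis D bC bD
    ∃ w : Module.Basis {k : I ⊕ J // k ≠ Sum.inr j₀} (ZMod 2) T.H0,
      (∀ k, (sandwichMap V C D f g).mapH0 (b k) = w (mergeIndex i₀ j₀ k)) ∧
      interpX (LinearMap.toMatrix b w (sandwichMap V C D f g).mapH0) = splitMap i₀ j₀ ∧
      ∀ R : ℕ, min (C.directSum D).dist T.distZ ≤ R →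
        ∃ dec : SplitRecord R Vm (Z₁ ⊕ Z₂) (X₁ ⊕ X₂) → Pauli (Q₁ ⊕ Q₂),
          (C.directSum D).SplitImplements dec (T.encode w) ((C.directSum D).encode b)
            (splitMap i₀ j₀) ∧
          (C.directSum D).SplitFaultTolerant dec (T.encode w) ((C.directSum D).encode b)
            (splitMap i₀ j₀) (min (C.directSum D).dist T.distZ) := by

  intro T b
  obtain ⟨w, hw⟩ := hsep.exists_basis hu hv
  refine ⟨w, hw, interpX_toMatrix_eq_splitMap b w _ hw, fun R hR => ?_⟩
  obtain ⟨S, hS⟩ := Matrix.mulVec_surjective_iff_exists_right_inverse.mp hu.onto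
  refine CSSCode.exists_splitImplements_and_splitFaultTolerant (C.directSum D) hR
    (fromRows f.f₀ g.f₀ * S) (fun φ => CSSCode.isCodeState_encode _ _ _)
    (hsep.measureOutX_encode hu hv hw hS) (fun x hx hd φ => ?_) fun z a h hd φ => ?_
  · refine (CSSCode.isCodeState_encode _ _ _).act_x_eq_self ?_
    exact CSSCode.mem_boundaries_of_hammingNorm_lt _ hx
      (hd.trans_le ((min_le_left _ _).trans (min_le_right _ _)))
  · exact hsep.act_z_eq_self hu hv hS h (hd.trans_le (min_le_right _ _)) φ
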